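/- Let $\mathcal H$ be a complex Hilbert space (the one-particle space) and let $\mathcal F$ be the fermion Fock space over $\mathcal H$, the Hilbert space direct sum of the completed exterior powers $\Lambda^n\mathcal H$, $n\ge 0$, with number operator $\hat n$ (multiplication by $n$ on $\Lambda^n\mathcal H$). An ordered orthonormal basis $(f_i)$ of $\mathcal H$ determines the Fock basis $\{|\mathfrak n\rangle\}$ of $\mathcal F$, indexed by the occupation lists $\mathfrak n$ with entries $\mathfrak n(i)\in\{0,1\}$ and $\sum_i\mathfrak n(i)<\infty$, where $|\mathfrak n\rangle$ is the wedge product, in increasing order, of the $f_i$ with $\mathfrak n(i)=1$. A density operator is a positive operator of trace one. A bounded Hermitian operator $\gamma$ on $\mathcal H$ is the 1-matrix of a density operator $\Delta$ on $\mathcal F$ if, for every ordered orthonormal basis $(f_i)$ of $\mathcal H$ and every $i$, $\langle f_i|\gamma| f_i\rangle=\sum_{\mathfrak n:\,\mathfrak n(i)=1}\langle\mathfrak n|\Delta|\mathfrak n\rangle$. A density operator $\Gamma$ on $\mathcal F$ is free if $$\Gamma=\sum_{\mathfrak n}\Big\{\prod_i p_i^{\mathfrak n(i)}(1-p_i)^{1-\mathfrak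 n(i)}\Big\}\,|\mathfrak n\rangle\langle\mathfrak n|$$ for the Fock basis of some ordered orthonormal basis of $\mathcal H$ and some $p_i\in[0,1]$ with $\sum_i p_i<\infty$ (here $0^0=1$). For density operators $\Delta,\Gamma$, $\mathrm{Tr}(\Delta\log\Gamma)\in[-\infty,0]$ is understood with $0\log 0=0$ (it equals $\sum_j\langle e_j|\Delta|e_j\rangle\log\mu_j$ if $(e_j)$ is an orthonormal basis with $\Gamma e_j=\mu_je_j$, a term being $0$ if $\langle e_j|\Delta|e_j\rangle=0$ and $-\infty$ if $\mu_j=0\neq\langle e_j|\Delta|e_j\rangle$). If $\mathrm{Tr}(\Delta\log\Delta)>-\infty$, the relative entropy is $S(\Delta|\Gamma)=-\mathrm{Tr}(\Delta\log\Gamma)+\mathrm{Tr}(\Delta\log\Delta)\in(-\infty,\infty]$. Let $\Delta$ be a density operator on $\mathcal F$ that commutes with $\hat n$ and satisfies $\mathrm{Tr}(\hat n\Delta)<\infty$ and $\mathrm{Tr}(\Delta\log\Delta)>-\infty$. Then $\Delta$ has a unique 1-matrix $\gamma_\Delta$; there is a unique free density operator $\Gamma_\Delta$ with 1-matrix $\gamma_\Delta$;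 and $\mathcal H$ has an orthonormal basis of eigenvectors of $\gamma_\Delta$. For every such eigenbasis, the eigenvalues $n_i$, listed along the basis (the natural occupation numbers of $\Delta$), lie in $[0,1]$, and $$S(\Delta|\Gamma_\Delta)=-\sum_i n_i\log n_i-\sum_i(1-n_i)\log(1-n_i)+\mathrm{Tr}(\Delta\log\Delta),$$ as an identity in $(-\infty,\infty]$. Moreover $$S(\Delta|\Gamma_\Delta)=\min\{S(\Delta|\Gamma):\ \Gamma\text{ is a free density operator on }\mathcal F\},$$ and if $\mathrm{Tr}(\Delta\log\Gamma_\Delta)>-\infty$, this minimum is attained only at $\Gamma_\Delta$. -/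

import Mathlib

open scoped ENNReal

universe u

noncomputable section

namespace FermionFock

/-! ## The fermion Fock space over a complex Hilbert space -/

section ExteriorPower

open scoped Matrix ComplexOrder

variable (H : Type u) [NormedAddCommGroup H] [InnerProductSpace ℂ H] (n : ℕ)

/-- The algebraic `n`-th exterior power of `H`, to be equipped with the inner product
`⟪v₁ ∧ ⋯ ∧ vₙ, w₁ ∧ ⋯ ∧ wₙ⟫ = det (⟪vᵢ, wⱼ⟫)`. -/
def AlgExterior : Type u := ⋀[ℂ]^n H

instance : AddCommGroup (AlgExterior H n) := inferInstanceAs (AddCommGroup (⋀[ℂ]^n H))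

instance : Module ℂ (AlgExterior H n) := inferInstanceAs (Module ℂ (⋀[ℂ]^n H))

variable {H n}

/-- The vector `v₁ ∧ ⋯ ∧ vₙ`. -/
def algWedge (v : Fin n → H) : AlgExterior H n := exteriorPower.ιMulti ℂ n v

variable (H n)

/-- The form `η ↦ (ω ↦ ⟪ω, η⟫)`, linear in `η` and conjugate-linear in `ω`, that is given by
`det (⟪vᵢ, wⱼ⟫)` for `ω = v₁ ∧ ⋯ ∧ vₙ` and `η = w₁ ∧ ⋯ ∧ wₙ`. -/
def gramForm : AlgExterior H n →ₗ[ℂ] (AlgExterior H n →ₗ⋆[ℂ] ℂ) :=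
  exteriorPower.alternatingMapLinearEquiv (R := ℂ) (M := H)
    (N := (⋀[ℂ]^n H) →ₗ⋆[ℂ] ℂ)
    { toFun := fun w =>
        (starLinearEquiv ℂ (A := ℂ)).toLinearMap.comp
          (exteriorPower.alternatingMapToDual ℂ H n (fun i => innerₛₗ ℂ (w i)))
      map_update_add' := by
        intro _ w i x y
        have h : ∀ z : H, (fun j => innerₛₗ ℂ (Function.update w i z j))
            = Function.update (fun j => innerₛₗ ℂ (w j)) i (innerₛₗ ℂ z) := by
          intro z
          exact Function.comp_update (innerₛₗ ℂ) w i z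
        simp only [h, map_add, AlternatingMap.map_update_add]
        ext; simp
      map_update_smul' := by
        intro _ w i c x
        have h : ∀ z : H, (fun j => innerₛₗ ℂ (Function.update w i z j))
            = Function.update (fun j => innerₛₗ ℂ (w j)) i (innerₛₗ ℂ z) := by
          intro z
          exact Function.comp_update (innerₛₗ ℂ) w i z
        simp only [h, map_smulₛₗ, AlternatingMap.map_update_smul]
        ext; simp
      map_eq_zero_of_eq' := by
        intro w i j hij hne
        have h0 : exteriorPower.alternatingMapToDual ℂ H n (fun i => innerₛₗ ℂ (w i)) = 0 :=
          AlternatingMap.map_eq_zero_of_eq _ _ (by simp only [hij]) hne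
        rw [h0]
        ext; simp }

variable {H n}

theorem gramForm_algWedge (v w : Fin n → H) :
    gramForm H n (algWedge w) (algWedge v)
      = Matrix.det (Matrix.of fun i j => inner ℂ (v i) (w j)) := by
  have h : gramForm H n (algWedge w) = (starLinearEquiv ℂ (A := ℂ)).toLinearMap.comp
          (exteriorPower.alternatingMapToDual ℂ H n (fun i => innerₛₗ ℂ (w i))) :=
    exteriorPower.alternatingMapLinearEquiv_apply_ιMulti (R := ℂ) (M := H)
      (N := (⋀[ℂ]^n H) →ₗ⋆[ℂ] ℂ) _ _
  rw [h]
  have h2 : exteriorPower.alternatingMapToDual ℂ H n (fun i => innerₛₗ ℂ (w i))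
      (exteriorPower.ιMulti ℂ n v)
      = Matrix.det (Matrix.of fun i j => inner ℂ (w j) (v i)) := by
    rw [exteriorPower.alternatingMapToDual_apply_ιMulti]
    rfl
  change star (exteriorPower.alternatingMapToDual ℂ H n (fun i => innerₛₗ ℂ (w i))
      (exteriorPower.ιMulti ℂ n v)) = _
  rw [h2, ← Matrix.det_conjTranspose, ← Matrix.det_transpose]
  congr 1
  ext i j
  simp [Matrix.conjTranspose_apply]

theorem span_algWedge : Submodule.span ℂ (Set.range (algWedge : (Fin n → H) → AlgExterior H n)) = ⊤ :=
  exteriorPower.ιMulti_span ℂ n H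

theorem exists_eq_sum_algWedge (x : AlgExterior H n) :
    ∃ c : (Fin n → H) →₀ ℂ, x = ∑ v ∈ c.support, c v • algWedge v := by
  have hx : x ∈ Submodule.span ℂ (Set.range (algWedge : (Fin n → H) → AlgExterior H n)) := by
    rw [span_algWedge]; trivial
  obtain ⟨c, hc⟩ := (Finsupp.mem_span_range_iff_exists_finsupp).1 hx
  exact ⟨c, hc.symm⟩

theorem gramForm_conj_symm (x y : AlgExterior H n) :
    (starRingEnd ℂ) (gramForm H n x y) = gramForm H n y x := by
  obtain ⟨c, rfl⟩ := exists_eq_sum_algWedge x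
  obtain ⟨d, rfl⟩ := exists_eq_sum_algWedge y
  simp only [map_sum, map_smul, LinearMap.sum_apply, LinearMap.smul_apply, map_smulₛₗ,
    gramForm_algWedge, smul_eq_mul, map_mul, Finset.mul_sum, Complex.conj_conj]
  rw [Finset.sum_comm]
  refine Finset.sum_congr rfl fun v _ => Finset.sum_congr rfl fun w _ => ?_
  have h : (starRingEnd ℂ) (Matrix.det (Matrix.of fun i j => inner ℂ (w i) (v j)))
      = Matrix.det (Matrix.of fun i j => inner ℂ (v i) (w j)) := by
    rw [starRingEnd_apply, ← Matrix.det_conjTranspose]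
    congr 1
    ext i j
    simp [Matrix.conjTranspose_apply]
  rw [h]
  ring

theorem posSemidef_prod_gram {J : Type*} [Finite J] (s : Finset (Fin n)) (a : J → Fin n → H) :
    (Matrix.of fun p q : J => ∏ i ∈ s, inner ℂ (a p i) (a q i)).PosSemidef := by
  classical
  induction s using Finset.induction_on with
  | empty =>
    have h := Matrix.posSemidef_gram ℂ (fun _ : J => (1 : ℂ))
    have e : (Matrix.of fun p q : J => ∏ i ∈ (∅ : Finset (Fin n)), inner ℂ (a p i) (a q i))
        = Matrix.gram ℂ (fun _ : J => (1 : ℂ)) := by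
      ext p q
      simp [Matrix.gram_apply]
    rw [e]
    exact h
  | insert i s hi ih =>
    have h := (Matrix.posSemidef_gram ℂ (fun p : J => a p i)).hadamard ih
    have e : (Matrix.of fun p q : J => ∏ j ∈ insert i s, inner ℂ (a p j) (a q j))
        = Matrix.hadamard (Matrix.gram ℂ (fun p : J => a p i))
          (Matrix.of fun p q : J => ∏ j ∈ s, inner ℂ (a p j) (a q j)) := by
      ext p q
      simp [Matrix.gram_apply, Finset.prod_insert hi]
    rw [e]
    exact h

theorem factorial_mul_det (v w : Fin n → H) :
    ((n.factorial : ℕ) : ℂ) * Matrix.det (Matrix.of fun i j => inner ℂ (v i) (w j))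
      = ∑ τ : Equiv.Perm (Fin n), ∑ σ : Equiv.Perm (Fin n),
          ((Equiv.Perm.sign σ : ℤ) : ℂ) * ((Equiv.Perm.sign τ : ℤ) : ℂ)
            * ∏ i, inner ℂ (v (σ i)) (w (τ i)) := by
  have h : ∀ τ : Equiv.Perm (Fin n), ∑ σ : Equiv.Perm (Fin n),
          ((Equiv.Perm.sign σ : ℤ) : ℂ) * ((Equiv.Perm.sign τ : ℤ) : ℂ)
            * ∏ i, inner ℂ (v (σ i)) (w (τ i))
      = Matrix.det (Matrix.of fun i j => inner ℂ (v i) (w j)) := by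
    intro τ
    have h1 := Matrix.det_permute' τ (Matrix.of fun i j => inner ℂ (v i) (w j))
    rw [Matrix.det_apply'] at h1
    have h2 : ((Equiv.Perm.sign τ : ℤ) : ℂ) * ((Equiv.Perm.sign τ : ℤ) : ℂ) = 1 := by
      rcases Int.units_eq_one_or (Equiv.Perm.sign τ) with h | h <;> simp [h]
    calc _ = ((Equiv.Perm.sign τ : ℤ) : ℂ) * ∑ σ : Equiv.Perm (Fin n),
              ((Equiv.Perm.sign σ : ℤ) : ℂ) * ∏ i, inner ℂ (v (σ i)) (w (τ i)) := by
            rw [Finset.mul_sum]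
            exact Finset.sum_congr rfl fun σ _ => by ring
      _ = ((Equiv.Perm.sign τ : ℤ) : ℂ) * (((Equiv.Perm.sign τ : ℤ) : ℂ)
            * Matrix.det (Matrix.of fun i j => inner ℂ (v i) (w j))) := by
            rw [← h1]; rfl
      _ = _ := by rw [← mul_assoc, h2, one_mul]
  rw [Finset.sum_congr rfl fun τ _ => h τ]
  simp [Fintype.card_perm]

theorem gramForm_self_nonneg (x : AlgExterior H n) : 0 ≤ (gramForm H n x x).re := by
  classical
  obtain ⟨c, rfl⟩ := exists_eq_sum_algWedge x
  let a : c.support × Equiv.Perm (Fin n) → Fin n → H := fun p i => p.1.1 (p.2 i)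
  let z : c.support × Equiv.Perm (Fin n) → ℂ :=
    fun p => c p.1.1 * ((Equiv.Perm.sign p.2 : ℤ) : ℂ)
  have hpos := (posSemidef_prod_gram Finset.univ a).dotProduct_mulVec_nonneg z
  have key : ((n.factorial : ℕ) : ℂ)
      * gramForm H n (∑ v ∈ c.support, c v • algWedge v) (∑ v ∈ c.support, c v • algWedge v)
      = star z ⬝ᵥ ((Matrix.of fun p q => ∏ i ∈ Finset.univ, inner ℂ (a p i) (a q i)) *ᵥ z) := by
    have hL : gramForm H n (∑ v ∈ c.support, c v • algWedge v)
        (∑ v ∈ c.support, c v • algWedge v)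
        = ∑ v : c.support, ∑ w : c.support, star (c v) * c w
          * Matrix.det (Matrix.of fun i j => inner ℂ (v.1 i) (w.1 j)) := by
      rw [← Finset.sum_coe_sort c.support]
      simp only [map_sum, map_smul, LinearMap.sum_apply, LinearMap.smul_apply, map_smulₛₗ,
        gramForm_algWedge, smul_eq_mul, Finset.mul_sum]
      refine Finset.sum_congr rfl fun v _ => Finset.sum_congr rfl fun w _ => ?_
      rw [starRingEnd_apply]
      ring
    rw [hL]
    simp only [dotProduct, Matrix.mulVec, Matrix.of_apply, Finset.mul_sum, Pi.star_apply,
      Fintype.sum_prod_type]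
    refine Finset.sum_congr rfl fun v _ => ?_
    rw [Finset.sum_comm]
    refine Finset.sum_congr rfl fun w _ => ?_
    rw [mul_left_comm, factorial_mul_det, Finset.mul_sum, Finset.sum_comm]
    refine Finset.sum_congr rfl fun σ _ => ?_
    rw [Finset.mul_sum]
    refine Finset.sum_congr rfl fun τ _ => ?_
    simp only [a, z, star_mul', star_intCast]
    ring
  have h2 : (0 : ℝ) ≤ (((n.factorial : ℕ) : ℂ)
      * gramForm H n (∑ v ∈ c.support, c v • algWedge v)
        (∑ v ∈ c.support, c v • algWedge v)).re := by
    rw [key]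
    exact (Complex.le_def.1 hpos).1
  have h3 : (0 : ℝ) < (n.factorial : ℝ) := by exact_mod_cast n.factorial_pos
  rw [← Complex.ofReal_natCast, Complex.re_ofReal_mul] at h2
  exact nonneg_of_mul_nonneg_right h2 h3

instance : PreInnerProductSpace.Core ℂ (AlgExterior H n) where
  inner x y := gramForm H n y x
  conj_inner_symm x y := gramForm_conj_symm x y
  re_inner_nonneg x := gramForm_self_nonneg x
  add_left x y z := by simp
  smul_left x y r := by simp

instance : SeminormedAddCommGroup (AlgExterior H n) :=
  InnerProductSpace.Core.toSeminormedAddCommGroup (𝕜 := ℂ)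

instance : InnerProductSpace ℂ (AlgExterior H n) := .ofCore _

theorem inner_algWedge (v w : Fin n → H) :
    inner ℂ (algWedge v) (algWedge w) = Matrix.det (Matrix.of fun i j => inner ℂ (v i) (w j)) :=
  gramForm_algWedge v w

end ExteriorPower

section Fock

variable (H : Type u) [NormedAddCommGroup H] [InnerProductSpace ℂ H]

/-- The `n`-fermion Hilbert space: the Hilbert space completion of the `n`-th exterior power. -/
abbrev Sector (n : ℕ) : Type u := UniformSpace.Completion (AlgExterior H n)

/-- The fermion Fock space over `H`: the Hilbert space direct sum of the `n`-fermion spaces. -/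
abbrev Fock : Type u := lp (fun n : ℕ => Sector H n) 2

variable {H}

/-- The vector `v₁ ∧ ⋯ ∧ vₙ` of the Fock space. It has norm one if the `vᵢ` are orthonormal. -/
def wedge {n : ℕ} (v : Fin n → H) : Fock H :=
  lp.single 2 n ((algWedge v : AlgExterior H n) : Sector H n)

/-- The Fock basis vector `|𝔫⟩` of an ordered family `f` of modes. A fermionic occupation list `𝔫`
(entries `0` or `1`, finite total number) is encoded by the finite set `s` of the occupied modes,
and `|s⟩ = f_{i₁} ∧ ⋯ ∧ f_{iₙ}` where `i₁ < ⋯ < iₙ` are the elements of `s`. -/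
def fockVector {ι : Type*} [LinearOrder ι] (f : ι → H) (s : Finset ι) : Fock H :=
  wedge (fun k : Fin s.card => f (s.orderEmbOfFin rfl k))

variable (H)

/-- The number operator, the self-adjoint operator that acts as multiplication by `n` on the
`n`-fermion space, with its maximal domain. -/
def numberOperator : Fock H →ₗ.[ℂ] Fock H where
  domain :=
    { carrier := {x | Memℓp (fun n : ℕ => (n : ℂ) • (x : ∀ n, Sector H n) n) 2}
      add_mem' := by
        intro x y hx hy
        refine (congrArg (fun g => Memℓp g 2) (funext fun n => ?_)).mp (Memℓp.add hx hy)
        exact (smul_add (n : ℂ) _ _).symm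
      zero_mem' := by
        refine (congrArg (fun g => Memℓp g 2) (funext fun n => ?_)).mp
          (zero_memℓp : Memℓp (0 : ∀ n : ℕ, Sector H n) 2)
        exact (smul_zero (n : ℂ)).symm
      smul_mem' := by
        intro c x hx
        refine (congrArg (fun g => Memℓp g 2) (funext fun n => ?_)).mp (Memℓp.const_smul hx c)
        exact smul_comm c (n : ℂ) _ }
  toFun :=
    { toFun := fun x => ⟨fun n : ℕ => (n : ℂ) • (x.1 : ∀ n, Sector H n) n, x.2⟩
      map_add' := fun x y => lp.ext (funext fun n => smul_add (n : ℂ) _ _)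
      map_smul' := fun c x => lp.ext (funext fun n => smul_comm (n : ℂ) c _) }

/-- The orthogonal projector of the Fock space onto the `n`-fermion space. -/
def sectorProj (n : ℕ) : Fock H →L[ℂ] Fock H :=
  (lp.singleContinuousLinearMap ℂ (fun n : ℕ => Sector H n) 2 n).comp
    (lp.evalCLM ℂ (fun n : ℕ => Sector H n) 2 n)

end Fock

/-! ## Traces, density operators and relative entropy -/

section Trace

variable {K : Type u} [NormedAddCommGroup K] [InnerProductSpace ℂ K] [CompleteSpace K]

/-- An orthonormal basis of the Hilbert space `K`. -/
def someBasis (K : Type u) [NormedAddCommGroup K] [InnerProductSpace ℂ K] [CompleteSpace K] :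
    HilbertBasis (exists_hilbertBasis ℂ K).choose ℂ K :=
  (exists_hilbertBasis ℂ K).choose_spec.choose

/-- The trace `∑ᵢ ⟨bᵢ, T bᵢ⟩ ∈ [0, ∞]` of a positive operator `T`, in any orthonormal basis. -/
def trace (T : K →L[ℂ] K) : ℝ≥0∞ :=
  ∑' i, ENNReal.ofReal (inner ℂ (someBasis K i) (T (someBasis K i))).re

theorem ofReal_norm_sq_eq_tsum {ι : Type*} (c : HilbertBasis ι ℂ K) (x : K) :
    ENNReal.ofReal (‖x‖ ^ 2) = ∑' i, ENNReal.ofReal (‖inner ℂ (c i) x‖ ^ 2) := by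
  have h := (c.hasSum_inner_mul_inner x x).mapL Complex.reCLM
  have h2 : HasSum (fun i => ‖inner ℂ (c i) x‖ ^ 2) (‖x‖ ^ 2) := by
    convert h using 1
    · ext i
      rw [← inner_conj_symm x (c i), ← Complex.normSq_eq_conj_mul_self, Complex.reCLM_apply,
        Complex.ofReal_re, Complex.normSq_eq_norm_sq]
    · exact (inner_self_eq_norm_sq (𝕜 := ℂ) x).symm
  rw [← h2.tsum_eq, ENNReal.ofReal_tsum_of_nonneg (fun _ => sq_nonneg _) h2.summable]

/-- The trace of a positive operator does not depend on the orthonormal basis. -/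
theorem trace_eq_tsum {T : K →L[ℂ] K} (hT : T.IsPositive) {ι : Type*} (b : HilbertBasis ι ℂ K) :
    trace T = ∑' i, ENNReal.ofReal (inner ℂ (b i) (T (b i))).re := by
  have hT0 : 0 ≤ T := (ContinuousLinearMap.nonneg_iff_isPositive T).2 hT
  have hS : IsSelfAdjoint (CFC.sqrt T) := IsSelfAdjoint.of_nonneg (CFC.sqrt_nonneg T)
  have hsym : ∀ x y : K, inner ℂ (CFC.sqrt T x) y = inner ℂ x (CFC.sqrt T y) := fun x y =>
    hS.isSymmetric x y
  have hsq : ∀ x : K, (inner ℂ x (T x)).re = ‖CFC.sqrt T x‖ ^ 2 := by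
    intro x
    conv_lhs => rw [← CFC.sqrt_mul_sqrt_self T hT0]
    rw [mul_apply_eq_comp, ← hsym]
    exact inner_self_eq_norm_sq (𝕜 := ℂ) (CFC.sqrt T x)
  have hsymm : ∀ x y : K, ‖inner ℂ x (CFC.sqrt T y)‖ = ‖inner ℂ y (CFC.sqrt T x)‖ := by
    intro x y
    rw [← hsym, norm_inner_symm]
  unfold trace
  simp only [hsq]
  calc _ = ∑' i, ∑' j, ENNReal.ofReal (‖inner ℂ (b j) (CFC.sqrt T (someBasis K i))‖ ^ 2) :=
        tsum_congr fun i => ofReal_norm_sq_eq_tsum b _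
    _ = ∑' j, ∑' i, ENNReal.ofReal (‖inner ℂ (b j) (CFC.sqrt T (someBasis K i))‖ ^ 2) :=
        ENNReal.tsum_comm
    _ = ∑' j, ∑' i, ENNReal.ofReal (‖inner ℂ (someBasis K i) (CFC.sqrt T (b j))‖ ^ 2) :=
        tsum_congr fun j => tsum_congr fun i => by rw [hsymm]
    _ = _ := tsum_congr fun j => (ofReal_norm_sq_eq_tsum (someBasis K) _).symm

/-- A density operator: a positive operator of trace one. -/
def IsDensityOperator (D : K →L[ℂ] K) : Prop :=
  D.IsPositive ∧ trace D = 1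

/-- `Tr (D A) = Tr (D^{1/2} A D^{1/2}) ∈ [0, ∞]` for positive bounded operators `D` and `A`. -/
def expectation (D A : K →L[ℂ] K) : ℝ≥0∞ :=
  trace (CFC.sqrt D * A * CFC.sqrt D)

/-- `-log (max (G, ε))`, a positive bounded operator if `0 ≤ G ≤ 1` and `0 < ε ≤ 1`. It increases
to `-log G` (which is `+∞` on the kernel of `G`) as `ε` decreases to `0`. -/
def negLogTrunc (G : K →L[ℂ] K) (ε : ℝ) : K →L[ℂ] K :=
  cfc (fun t : ℝ => -Real.log (max t ε)) G

/-- `Tr (D log G) ∈ [-∞, 0]` for density operators `D` and `G`, where `0 log 0 = 0`: minus the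
limit (the supremum) of `Tr (D (-log (max (G, ε))))` as `ε` decreases to `0`. If `(fⱼ)` is an
orthonormal basis with `G fⱼ = μⱼ fⱼ`, this is `∑ⱼ ⟨fⱼ, D fⱼ⟩ log μⱼ`; it is `-∞` if `⟨fⱼ, D fⱼ⟩ ≠ 0`
for some `j` with `μⱼ = 0`. -/
def traceMulLog (D G : K →L[ℂ] K) : EReal :=
  -((⨆ ε ∈ Set.Ioc (0 : ℝ) 1, expectation D (negLogTrunc G ε) : ℝ≥0∞) : EReal)

/-- The entropy `S(D|G) = -Tr (D log G) + Tr (D log D)` of `D` relative to `G`, with values in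
`(-∞, ∞]`, for density operators with `Tr (D log D) > -∞`. -/
def relEntropy (D G : K →L[ℂ] K) : EReal :=
  -traceMulLog D G + traceMulLog D D

end Trace

/-! ## Fermion states -/

section States

variable {H : Type u} [NormedAddCommGroup H] [InnerProductSpace ℂ H] [CompleteSpace H]

/-- The bounded operator `D` commutes with the number operator `N`: it maps the domain of `N` into
itself and `N D = D N` there. -/
def CommutesWithNumber (D : Fock H →L[ℂ] Fock H) : Prop :=
  ∀ x : (numberOperator H).domain, ∃ h : D x ∈ (numberOperator H).domain,
    numberOperator H ⟨D x, h⟩ = D (numberOperator H x)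

/-- The mean particle number `Tr (N D) = ∑ₙ n Tr (D Pₙ)`, where `Pₙ` is the projector onto the
`n`-fermion space. -/
def meanNumber (D : Fock H →L[ℂ] Fock H) : ℝ≥0∞ :=
  ∑' n : ℕ, (n : ℝ≥0∞) * expectation D (sectorProj H n)

/-- The bounded operator `γ` is the 1-matrix of `D`: it is Hermitian, and for every ordered
orthonormal basis `f` of the one-particle space and every `i`, `⟨fᵢ, γ fᵢ⟩` is the average
occupation `∑_{𝔫 : 𝔫(i) = 1} ⟨𝔫|D|𝔫⟩` of the mode `fᵢ` in the state `D`. -/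
def IsOneMatrix (D : Fock H →L[ℂ] Fock H) (γ : H →L[ℂ] H) : Prop :=
  IsSelfAdjoint γ ∧
  ∀ (ι : Type u) [LinearOrder ι] (f : HilbertBasis ι ℂ H) (i : ι),
    HasSum (fun s : {s : Finset ι // i ∈ s} =>
        inner ℂ (fockVector f s.1) (D (fockVector f s.1)))
      (inner ℂ (f i) (γ (f i)))

/-- A free (quasi-free) density operator
`G = ∑_𝔫 {∏ᵢ pᵢ^{𝔫(i)} (1 - pᵢ)^{1 - 𝔫(i)}} |𝔫⟩⟨𝔫|` with `pᵢ ∈ [0, 1]`, `∑ᵢ pᵢ < ∞`, where `|𝔫⟩` is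
the Fock basis of some ordered orthonormal basis of the one-particle space. -/
def IsFree (G : Fock H →L[ℂ] Fock H) : Prop :=
  IsDensityOperator G ∧
  ∃ (ι : Type u) (_ : LinearOrder ι) (f : HilbertBasis ι ℂ H) (p : ι → ℝ),
    (∀ i, p i ∈ Set.Icc (0 : ℝ) 1) ∧ Summable p ∧
    ∀ x : Fock H,
      HasSum (fun s : Finset ι =>
        (((∏' i, if i ∈ s then p i else 1 - p i : ℝ) : ℂ) * inner ℂ (fockVector f s) x)
          • fockVector f s) (G x)

end States

end FermionFock

end

open FermionFock

/-! ## Diagonal operators on Hilbert spaces -/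

namespace FermionFock

open Filter Topology ComplexConjugate

section Hilbert

variable {K : Type u} [NormedAddCommGroup K] [InnerProductSpace ℂ K]

/-! The 1-matrix of `D` is γ with ⟨x, γ y⟩ = Tr(a(x) D a†(y)). It is built as A†A, where A sends h
to the Hilbert–Schmidt operator √D a†(h) (`momentOperator`). Its diagonal entries in any orthonormal
basis are the mode occupations, and the quadratic form determines it. Its trace is the mean particle
number, hence finite, so γ is compact and has an eigenbasis. The eigenvalues n_i lie in [0,1] and
are summable, and the Bernoulli weights built from them define a free state with 1-matrix γ.

A free state is determined by its 1-matrix. The modes f of a free state form an eigenbasis of γ with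
eigenvalues p. If two Fock vectors from two eigenbases overlap, some nonzero term of the Gram
determinant matches their occupied eigenvalues. The weight depends only on these eigenvalues and on
the full list of eigenvalues, so both states have the same matrix elements (`weight_eq_weight`,
`IsFree.eq_of_isOneMatrix`).

For the minimum, let F be free with modes f and parameters p. The negative logarithm of a weight is
a sum over modes, so -Tr(D log F) = ∑_i c(⟨f_i, γ f_i⟩, p_i) with the Bernoulli cross entropy c
(`traceMulLog_of_weight`). Since c is affine in its first argument, this equals ∑_ij |⟨g_j, f_i⟩|²
c(n_j, p_i) for an eigenbasis g of γ. Gibbs' inequality c(n, p) ≥ c(n, n) and Parseval bound it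
below by ∑_j c(n_j, n_j), which is the value at the free state with 1-matrix γ. If that value is
finite, equality forces n_j = p_i whenever g_j and f_i overlap. Then γ f_i = p_i f_i, so F has
1-matrix γ and is the same free state. All sums are taken in [0,∞], where they may be exchanged
freely. -/

theorem hasSum_norm_inner_sq {ι : Type*} (c : HilbertBasis ι ℂ K) (x : K) :
    HasSum (fun i => ‖inner ℂ (c i) x‖ ^ 2) (‖x‖ ^ 2) := by
  have h := (c.hasSum_inner_mul_inner x x).mapL Complex.reCLM
  convert h using 1
  · ext i
    rw [← inner_conj_symm x (c i), ← Complex.normSq_eq_conj_mul_self, Complex.reCLM_apply,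
      Complex.ofReal_re, Complex.normSq_eq_norm_sq]
  · exact (inner_self_eq_norm_sq (𝕜 := ℂ) x).symm

/-- In an eigenbasis, the components of `T x` are those of `x` times the eigenvalues. -/
theorem inner_apply_of_eigenbasis {ι : Type*} (e : HilbertBasis ι ℂ K) {T : K →L[ℂ] K}
    {a : ι → ℂ} (h : ∀ i, T (e i) = a i • e i) (i : ι) (x : K) :
    inner ℂ (e i) (T x) = a i * inner ℂ (e i) x := by
  classical
  have h1 : HasSum (fun j => inner ℂ (e i) (T (e.repr x j • e j))) (inner ℂ (e i) (T x)) :=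
    ((e.hasSum_repr x).mapL T).mapL (innerSL ℂ (e i))
  refine h1.unique ?_
  have h2 : ∀ j, j ≠ i → inner ℂ (e i) (T (e.repr x j • e j)) = 0 := by
    intro j hj
    rw [map_smul, h, inner_smul_right, inner_smul_right,
      e.orthonormal.inner_eq_zero (Ne.symm hj)]
    simp
  convert hasSum_single i h2 using 1
  rw [map_smul, h, inner_smul_right, inner_smul_right, e.repr_apply_apply,
    inner_self_eq_norm_sq_to_K, e.orthonormal.norm_eq_one]
  simp [mul_comm]

theorem hasSum_inner_apply_of_eigenbasis {ι : Type*} (e : HilbertBasis ι ℂ K) {T : K →L[ℂ] K}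
    {a : ι → ℝ} (h : ∀ i, T (e i) = (a i : ℂ) • e i) (x : K) :
    HasSum (fun i => a i * ‖inner ℂ (e i) x‖ ^ 2) (inner ℂ x (T x)).re := by
  have h1 := (e.hasSum_inner_mul_inner x (T x)).mapL Complex.reCLM
  convert h1 using 1
  ext i
  rw [inner_apply_of_eigenbasis e h, ← inner_conj_symm x (e i), mul_left_comm,
    ← Complex.normSq_eq_conj_mul_self, Complex.reCLM_apply, ← Complex.ofReal_mul,
    Complex.ofReal_re, Complex.normSq_eq_norm_sq]
  rfl

theorem ext_of_eigenbasis {ι : Type*} (e : HilbertBasis ι ℂ K) {T S : K →L[ℂ] K}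
    (h : ∀ i, T (e i) = S (e i)) : T = S := by
  refine ContinuousLinearMap.ext_on (s := Set.range e) ?_ ?_
  · exact Submodule.dense_iff_topologicalClosure_eq_top.2 e.dense_span
  · rintro _ ⟨i, rfl⟩
    exact h i

theorem inner_eq_zero_of_eigenvalue_ne {T : K →L[ℂ] K} (hT : T.IsSymmetric) {x y : K} {a b : ℝ}
    (hx : T x = (a : ℂ) • x) (hy : T y = (b : ℂ) • y) (hab : a ≠ b) : inner ℂ x y = 0 := by
  have h := hT x y
  change inner ℂ (T x) y = inner ℂ x (T y) at h
  rw [hx, hy, inner_smul_left, inner_smul_right, Complex.conj_ofReal, ← sub_eq_zero,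
    ← sub_mul, mul_eq_zero] at h
  rcases h with h | h
  · exact absurd (by exact_mod_cast sub_eq_zero.1 h) hab
  · exact h

/-- The sum of a function of the eigenvalues does not depend on the eigenbasis. -/
theorem tsum_eigenvalues_eq {T : K →L[ℂ] K} (hT : T.IsSymmetric) {ι κ : Type*}
    (e : HilbertBasis ι ℂ K) (g : HilbertBasis κ ℂ K) {a : ι → ℝ} {b : κ → ℝ}
    (he : ∀ i, T (e i) = (a i : ℂ) • e i) (hg : ∀ j, T (g j) = (b j : ℂ) • g j)
    (F : ℝ → ℝ≥0∞) : ∑' i, F (a i) = ∑' j, F (b j) := by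
  -- Parseval turns both sides into double series weighted by |⟨e_i, g_j⟩|². Wherever this overlap
  -- is nonzero, the two eigenvalues agree.
  have key' : ∑' j, F (b j)
      = ∑' j, ∑' i, F (b j) * ENNReal.ofReal (‖inner ℂ (e i) (g j)‖ ^ 2) := by
    refine tsum_congr fun j => ?_
    have h := hasSum_norm_inner_sq e (g j)
    rw [ENNReal.tsum_mul_left, ← ENNReal.ofReal_tsum_of_nonneg (fun _ => sq_nonneg _) h.summable,
      h.tsum_eq, g.orthonormal.norm_eq_one]
    simp
  have key1 : ∑' i, F (a i)
      = ∑' i, ∑' j, F (a i) * ENNReal.ofReal (‖inner ℂ (g j) (e i)‖ ^ 2) := by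
    refine tsum_congr fun i => ?_
    have h := hasSum_norm_inner_sq g (e i)
    rw [ENNReal.tsum_mul_left, ← ENNReal.ofReal_tsum_of_nonneg (fun _ => sq_nonneg _) h.summable,
      h.tsum_eq, e.orthonormal.norm_eq_one]
    simp
  rw [key1, key', ENNReal.tsum_comm]
  refine tsum_congr fun j => tsum_congr fun i => ?_
  rw [norm_inner_symm]
  by_cases hab : a i = b j
  · rw [hab]
  · rw [inner_eq_zero_of_eigenvalue_ne hT (he i) (hg j) hab]
    simp

/-! ### Square roots, compactness and eigenbases of positive operators -/

variable [CompleteSpace K]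

/-- The square root of a positive operator. -/
noncomputable def sqrtOp (D : K →L[ℂ] K) : K →L[ℂ] K := CFC.sqrt D

theorem isSelfAdjoint_sqrt (D : K →L[ℂ] K) : IsSelfAdjoint (sqrtOp D) :=
  IsSelfAdjoint.of_nonneg (CFC.sqrt_nonneg D)

theorem inner_sqrt_left (D : K →L[ℂ] K) (x y : K) :
    inner ℂ (sqrtOp D x) y = inner ℂ x (sqrtOp D y) :=
  (isSelfAdjoint_sqrt D).isSymmetric x y

theorem sqrt_sqrt_apply {D : K →L[ℂ] K} (hD : D.IsPositive) (x : K) :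
    sqrtOp D (sqrtOp D x) = D x := by
  have h := CFC.sqrt_mul_sqrt_self D ((ContinuousLinearMap.nonneg_iff_isPositive D).2 hD)
  exact DFunLike.congr_fun h x

theorem inner_apply_self {D : K →L[ℂ] K} (hD : D.IsPositive) (x : K) :
    inner ℂ x (D x) = ((‖sqrtOp D x‖ ^ 2 : ℝ) : ℂ) := by
  rw [← sqrt_sqrt_apply hD, ← inner_sqrt_left, inner_self_eq_norm_sq_to_K]
  simp

theorem re_inner_apply_self {D : K →L[ℂ] K} (hD : D.IsPositive) (x : K) :
    (inner ℂ x (D x)).re = ‖sqrtOp D x‖ ^ 2 := by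
  rw [inner_apply_self hD, Complex.ofReal_re]

/-- For a > 0 the vector y = (√D - √a) x is annihilated by √D + √a, which is bounded below by √a >
0, so y = 0. -/
theorem sqrt_apply_of_eigenvector {D : K →L[ℂ] K} (hD : D.IsPositive) {x : K} {a : ℝ}
    (ha : 0 ≤ a) (hx : D x = (a : ℂ) • x) : sqrtOp D x = (√a : ℂ) • x := by
  rcases ha.eq_or_lt with rfl | ha
  · have h := re_inner_apply_self hD x
    rw [hx] at h
    simp only [Complex.ofReal_zero, zero_smul, inner_zero_right, Complex.zero_re] at h
    have : sqrtOp D x = 0 := by simpa using h.symm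
    simp [this]
  · set y := sqrtOp D x - (√a : ℂ) • x with hy
    have h1 : sqrtOp D y + (√a : ℂ) • y = 0 := by
      rw [hy, map_sub, sqrt_sqrt_apply hD, hx, map_smul, smul_sub, smul_smul,
        ← Complex.ofReal_mul, Real.mul_self_sqrt ha.le]
      abel
    have h2 : (inner ℂ y (sqrtOp D y)).re + √a * ‖y‖ ^ 2 = 0 := by
      have h3 := congrArg (fun z => (inner ℂ y z).re) h1
      simp only [inner_add_right, inner_smul_right, inner_zero_right, Complex.add_re,
        Complex.zero_re, Complex.re_ofReal_mul] at h3
      rw [show (inner ℂ y y).re = ‖y‖ ^ 2 from inner_self_eq_norm_sq (𝕜 := ℂ) y] at h3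
      exact h3
    have h4 : 0 ≤ (inner ℂ y (sqrtOp D y)).re :=
      ((ContinuousLinearMap.nonneg_iff_isPositive _).1 (CFC.sqrt_nonneg D)).re_inner_nonneg_right y
    have h5 : √a * ‖y‖ ^ 2 = 0 := le_antisymm (by linarith) (by positivity)
    have h6 : y = 0 := by
      have := (Real.sqrt_pos.2 ha).ne'
      simpa [this] using h5
    exact sub_eq_zero.1 h6

/-- `Tr (D A) = ∑ₛ aₛ ⟨eₛ, D eₛ⟩` if `A eₛ = aₛ eₛ`. -/
theorem expectation_eq_tsum {ι : Type*} (e : HilbertBasis ι ℂ K) {D A : K →L[ℂ] K}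
    (hD : D.IsPositive) {a : ι → ℝ} (ha : ∀ i, 0 ≤ a i) (h : ∀ i, A (e i) = (a i : ℂ) • e i) :
    expectation D A
      = ∑' i, ENNReal.ofReal (a i) * ENNReal.ofReal (inner ℂ (e i) (D (e i))).re := by
  change trace (sqrtOp D * A * sqrtOp D) = _
  unfold trace
  -- Expanding √D y in the eigenbasis of A leaves nonnegative double sums. After exchanging them,
  -- Parseval collapses the sum over y to ‖√D e_i‖².
  have h1 : ∀ y : K, ENNReal.ofReal (inner ℂ y ((sqrtOp D * A * sqrtOp D) y)).re
      = ∑' i, ENNReal.ofReal (a i) * ENNReal.ofReal (‖inner ℂ y (sqrtOp D (e i))‖ ^ 2) := by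
    intro y
    have h2 := hasSum_inner_apply_of_eigenbasis e h (sqrtOp D y)
    rw [show (sqrtOp D * A * sqrtOp D) y = sqrtOp D (A (sqrtOp D y)) from rfl,
      ← inner_sqrt_left, ← h2.tsum_eq,
      ENNReal.ofReal_tsum_of_nonneg (fun i => mul_nonneg (ha i) (sq_nonneg _)) h2.summable]
    refine tsum_congr fun i => ?_
    rw [ENNReal.ofReal_mul (ha i), ← inner_sqrt_left, norm_inner_symm]
  simp only [h1]
  rw [ENNReal.tsum_comm]
  refine tsum_congr fun i => ?_
  rw [ENNReal.tsum_mul_left, ← ofReal_norm_sq_eq_tsum, re_inner_apply_self hD]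

/-- The finite trace makes √T Hilbert–Schmidt, hence a norm limit of finite-rank operators, and T =
√T √T inherits compactness. -/
theorem isCompactOperator_of_tsum_lt_top {ι : Type*} (b : HilbertBasis ι ℂ K) {T : K →L[ℂ] K}
    (hT : T.IsPositive) (h : ∑' i, ENNReal.ofReal (inner ℂ (b i) (T (b i))).re < ⊤) :
    IsCompactOperator T := by
  classical
  set S := sqrtOp T with hS
  have hsum : Summable fun i => ‖S (b i)‖ ^ 2 := by
    simp only [re_inner_apply_self hT] at h
    have h1 := ENNReal.summable_toReal h.ne
    simpa [ENNReal.toReal_ofReal, sq_nonneg] using h1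
  -- This is P_J √T, with P_J the projection onto the span of the b_i with i ∈ J, since √T is
  -- self-adjoint.
  let F : Finset ι → K →L[ℂ] K := fun J => ∑ i ∈ J, InnerProductSpace.rankOne ℂ (b i) (S (b i))
  have hF : ∀ J, IsCompactOperator (F J) := by
    intro J
    have h1 : F J ∈ compactOperator (RingHom.id ℂ) K K := by
      refine Submodule.sum_mem _ fun i _ => ?_
      change IsCompactOperator (InnerProductSpace.rankOne ℂ (b i) (S (b i)))
      rw [InnerProductSpace.rankOne_def']
      refine IsCompactOperator.comp_clm (f := ContinuousLinearMap.toSpanSingleton ℂ (b i)) ?_ _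
      exact ((isCompactOperator_id_iff_finiteDimensional (𝕜 := ℂ) (E := ℂ)).2 inferInstance).clm_comp
        (ContinuousLinearMap.toSpanSingleton ℂ (b i))
    exact h1
  have hFinner : ∀ J j x, inner ℂ (b j) (F J x) = if j ∈ J then inner ℂ (b j) (S x) else 0 := by
    intro J j x
    simp only [F, sum_apply, InnerProductSpace.rankOne_apply, inner_sum,
      inner_smul_right, orthonormal_iff_ite.1 b.orthonormal, hS, inner_sqrt_left]
    simp
  have hbound : ∀ J x, ‖(S - F J) x‖ ≤ √(∑' i : {i // i ∉ J}, ‖S (b i)‖ ^ 2) * ‖x‖ := by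
    intro J x
    refine le_of_sq_le_sq ?_ (by positivity)
    rw [mul_pow, Real.sq_sqrt (tsum_nonneg fun _ => sq_nonneg _)]
    have h1 := hasSum_norm_inner_sq b ((S - F J) x)
    have h2 : ∀ j, ‖inner ℂ (b j) ((S - F J) x)‖ ^ 2
        ≤ ({i | i ∉ J}.indicator (fun i => ‖S (b i)‖ ^ 2) j) * ‖x‖ ^ 2 := by
      intro j
      rw [sub_apply, inner_sub_right, hFinner]
      by_cases hj : j ∈ J
      · simp [hj]
      · rw [if_neg hj, Set.indicator_of_mem (by exact hj), sub_zero, hS, ← inner_sqrt_left,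
          ← mul_pow]
        gcongr
        exact norm_inner_le_norm _ _
    have h3 := h1.tsum_eq ▸ h1.summable.tsum_le_tsum h2
      ((hsum.indicator _).mul_right _)
    rw [tsum_mul_right] at h3
    rwa [show (∑' i : {i // i ∉ J}, ‖S (b i)‖ ^ 2) = _ from
      tsum_subtype {i | i ∉ J} (fun i => ‖S (b i)‖ ^ 2)]
  have htail : Tendsto (fun J : Finset ι => ∑' i : {i // i ∉ J}, ‖S (b i)‖ ^ 2) atTop (𝓝 0) :=
    tendsto_tsum_compl_atTop_zero fun i => ‖S (b i)‖ ^ 2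
  have hlim : Tendsto F atTop (𝓝 S) := by
    rw [tendsto_iff_norm_sub_tendsto_zero]
    have h1 : Tendsto (fun J : Finset ι => √(∑' i : {i // i ∉ J}, ‖S (b i)‖ ^ 2)) atTop (𝓝 0) := by
      simpa using htail.sqrt
    refine squeeze_zero (fun _ => norm_nonneg _) (fun J => ?_) h1
    rw [norm_sub_rev]
    exact ContinuousLinearMap.opNorm_le_bound _ (Real.sqrt_nonneg _) (hbound J)
  have hScomp : IsCompactOperator S := isCompactOperator_of_tendsto hlim (.of_forall hF)
  have h2 : (T : K → K) = S ∘ S := by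
    ext x
    exact (sqrt_sqrt_apply hT x).symm
  rw [h2]
  exact hScomp.comp_clm S

/-- A positive operator of finite trace has an orthonormal basis of eigenvectors. -/
theorem exists_eigenbasis {ι : Type*} (b : HilbertBasis ι ℂ K) {T : K →L[ℂ] K}
    (hT : T.IsPositive) (h : ∑' i, ENNReal.ofReal (inner ℂ (b i) (T (b i))).re < ⊤) :
    ∃ (κ : Type u) (g : HilbertBasis κ ℂ K) (n : κ → ℝ), ∀ i, T (g i) = (n i : ℂ) • g i := by
  classical
  have hc := isCompactOperator_of_tsum_lt_top b hT h
  -- By the spectral theorem for compact self-adjoint operators, the basis can be glued together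
  -- from Hilbert bases of the eigenspaces.
  have hbot := ContinuousLinearMap.orthogonalComplement_iSup_eigenspaces_eq_bot hc hT.isSymmetric
  let E : ℂ → Submodule ℂ K := fun μ => Module.End.eigenspace (T : Module.End ℂ K) μ
  have hclosed : ∀ μ, CompleteSpace (E μ) := by
    intro μ
    have : IsClosed (E μ : Set K) := by
      have : (E μ : Set K) = {x | T x = μ • x} := by
        ext x
        exact Module.End.mem_eigenspace_iff
      rw [this]
      exact isClosed_eq T.continuous (continuous_const_smul μ)
    exact this.completeSpace_coe
  have hfam : OrthogonalFamily ℂ (fun μ => E μ) fun μ => (E μ).subtypeₗᵢ :=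
    hT.isSymmetric.orthogonalFamily_eigenspaces
  choose w c hw using fun μ => exists_hilbertBasis ℂ (E μ)
  let v : (Σ μ, w μ) → K := fun a => (c a.1 a.2 : K)
  have horth : Orthonormal ℂ v :=
    hfam.orthonormal_sigma_orthonormal (fun μ => (c μ).orthonormal)
  have hspan : (Submodule.span ℂ (Set.range v))ᗮ = ⊥ := by
    suffices hle : (⨆ μ, E μ) ≤ (Submodule.span ℂ (Set.range v))ᗮᗮ by
      rw [eq_bot_iff, ← hbot]
      intro y hy u hu
      rw [← inner_conj_symm, hle hu y hy, map_zero]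
    refine iSup_le fun μ => ?_
    intro x hx
    have h1 : HasSum (fun i => (((c μ).repr ⟨x, hx⟩ i • c μ i : E μ) : K)) x :=
      ((c μ).hasSum_repr ⟨x, hx⟩).mapL (E μ).subtypeL
    rw [Submodule.mem_orthogonal]
    intro y hy
    have h2 := h1.mapL (innerSL ℂ y)
    refine h2.unique ?_
    convert hasSum_zero using 1
    ext i
    have h3 : inner ℂ y (v ⟨μ, i⟩) = 0 := by
      rw [← inner_conj_symm, hy _ (Submodule.subset_span ⟨_, rfl⟩)]
      simp
    simp only [Submodule.coe_smul, map_smul, innerSL_apply_apply]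
    rw [show inner ℂ y ((c μ i : E μ) : K) = 0 from h3, smul_zero]
  refine ⟨_, HilbertBasis.mkOfOrthogonalEqBot horth hspan,
    -- The eigenspaces are indexed by complex numbers; the real eigenvalue is recovered as a
    -- Rayleigh quotient.
    fun a => (inner ℂ (v a) (T (v a))).re, fun a => ?_⟩
  rw [HilbertBasis.coe_mkOfOrthogonalEqBot]
  change T (v a) = (((inner ℂ (v a) (T (v a))).re : ℝ) : ℂ) • v a
  have h1 : T (v a) = a.1 • v a := Module.End.mem_eigenspace_iff.1 (c a.1 a.2).2
  have h2 : inner ℂ (v a) (T (v a)) = a.1 := by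
    rw [h1, inner_smul_right, inner_self_eq_norm_sq_to_K, horth.1 a]
    simp
  have h3 : (((inner ℂ (v a) (T (v a))).re : ℝ) : ℂ) = a.1 := by
    rw [inner_apply_self hT] at h2 ⊢
    rw [Complex.ofReal_re, h2]
  rw [h3, h1]

/-- The continuous functional calculus on eigenvectors. -/
theorem cfc_apply_of_eigenvector {T : K →L[ℂ] K} (hT : IsSelfAdjoint T) {φ : ℝ → ℝ}
    (hφ : Continuous φ) {x : K} {μ : ℝ} (hx : T x = (μ : ℂ) • x) :
    cfc φ T x = (φ μ : ℂ) • x := by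
  rcases eq_or_ne x 0 with rfl | hx0
  · simp
  have hμ : μ ∈ spectrum ℝ T := by
    rw [spectrum.mem_iff]
    rintro ⟨U, hU⟩
    have h1 : (U : K →L[ℂ] K) x = 0 := by
      rw [hU, Algebra.algebraMap_eq_smul_one]
      simp [hx]
    have h2 : ((U⁻¹ : (K →L[ℂ] K)ˣ) : K →L[ℂ] K) ((U : K →L[ℂ] K) x) = x := by
      have := DFunLike.congr_fun U.inv_mul x
      exact this
    rw [h1, map_zero] at h2
    exact hx0 h2.symm
  -- The functions for which the claim holds form a closed subalgebra containing the polynomials,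
  -- hence all of C(spectrum) by Weierstrass.
  let V : Subalgebra ℝ C(spectrum ℝ T, ℝ) :=
    { carrier := {f | cfcHom hT f x = (f ⟨μ, hμ⟩ : ℂ) • x}
      mul_mem' := by
        intro f g hf hg
        simp only [Set.mem_ofPred_eq, map_mul] at *
        change cfcHom hT f (cfcHom hT g x) = _
        rw [hg, map_smul, hf, smul_smul, ContinuousMap.mul_apply, Complex.ofReal_mul, mul_comm]
      add_mem' := by
        intro f g hf hg
        simp only [Set.mem_ofPred_eq, map_add] at *
        rw [add_apply, hf, hg, ContinuousMap.add_apply, Complex.ofReal_add,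
          add_smul]
      algebraMap_mem' := by
        intro r
        simp only [Set.mem_ofPred_eq, AlgHomClass.commutes]
        rw [Algebra.algebraMap_eq_smul_one]
        simp }
  have hVclosed : IsClosed (V : Set C(spectrum ℝ T, ℝ)) := by
    refine isClosed_eq ?_ ?_
    · exact (ContinuousLinearMap.apply ℂ K x).continuous.comp (cfcHom_continuous hT)
    · exact ((Complex.continuous_ofReal.comp
        (continuous_eval_const (⟨μ, hμ⟩ : spectrum ℝ T)))).smul continuous_const
  have hpoly : polynomialFunctions (spectrum ℝ T) ≤ V := by
    rw [polynomialFunctions.eq_adjoin_X, Algebra.adjoin_le_iff]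
    rintro _ rfl
    have h1 : Polynomial.toContinuousMapOnAlgHom (spectrum ℝ T) Polynomial.X
        = (ContinuousMap.id ℝ).restrict (spectrum ℝ T) := by
      ext; simp
    change cfcHom hT _ x = _
    rw [h1, cfcHom_id]
    simpa using hx
  have hcomp : CompactSpace (spectrum ℝ T) := isCompact_iff_compactSpace.1
    (ContinuousFunctionalCalculus.isCompact_spectrum T)
  have htop : V = ⊤ := by
    rw [eq_top_iff, ← polynomialFunctions.topologicalClosure]
    exact Subalgebra.topologicalClosure_minimal hpoly hVclosed
  rw [cfc_apply φ T hT hφ.continuousOn]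
  have h2 : (⟨_, hφ.continuousOn.domRestrict⟩ : C(spectrum ℝ T, ℝ)) ∈ V := by
    rw [htop]; trivial
  exact h2

end Hilbert

end FermionFock

/-! ## The logarithm and `Tr (D log G)` -/

namespace FermionFock

open Filter Topology

/-- `-log x ∈ [0, ∞]` for `x ∈ [0, 1]`, with the value `∞` at `0`. -/
noncomputable def negLog (x : ℝ) : ℝ≥0∞ :=
  if x ≤ 0 then ⊤ else ENNReal.ofReal (-Real.log x)

theorem negLog_of_pos {x : ℝ} (hx : 0 < x) : negLog x = ENNReal.ofReal (-Real.log x) :=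
  if_neg hx.not_ge

@[simp]
theorem negLog_zero : negLog 0 = ⊤ := if_pos le_rfl

theorem ofReal_mul_negLog {x : ℝ} (hx : 0 ≤ x) :
    ENNReal.ofReal x * negLog x = ENNReal.ofReal (-(x * Real.log x)) := by
  rcases hx.eq_or_lt with rfl | hx
  · simp
  · rw [negLog_of_pos hx, ← ENNReal.ofReal_mul hx.le, mul_neg]

/-- `exp (-x)` for `x ∈ [0, ∞]`. -/
noncomputable def expNeg (x : ℝ≥0∞) : ℝ := if x = ⊤ then 0 else Real.exp (-x.toReal)

@[simp]
theorem expNeg_top : expNeg ⊤ = 0 := if_pos rfl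

@[simp]
theorem expNeg_zero : expNeg 0 = 1 := by simp [expNeg]

theorem expNeg_nonneg (x : ℝ≥0∞) : 0 ≤ expNeg x := by
  unfold expNeg
  split_ifs
  · exact le_rfl
  · positivity

theorem expNeg_add (x y : ℝ≥0∞) : expNeg (x + y) = expNeg x * expNeg y := by
  rcases eq_or_ne x ⊤ with rfl | hx
  · simp
  rcases eq_or_ne y ⊤ with rfl | hy
  · simp
  simp [expNeg, hx, hy, ENNReal.toReal_add hx hy, Real.exp_add, add_comm]

theorem expNeg_negLog {x : ℝ} (hx : x ∈ Set.Icc (0 : ℝ) 1) : expNeg (negLog x) = x := by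
  rcases hx.1.eq_or_lt with rfl | h0
  · simp
  · have h1 : 0 ≤ -Real.log x := by
      have := Real.log_nonpos h0.le hx.2
      linarith
    rw [negLog_of_pos h0, expNeg, if_neg ENNReal.ofReal_ne_top, ENNReal.toReal_ofReal h1, neg_neg,
      Real.exp_log h0]

theorem negLog_expNeg (x : ℝ≥0∞) : negLog (expNeg x) = x := by
  rcases eq_or_ne x ⊤ with rfl | hx
  · simp
  · rw [expNeg, if_neg hx, negLog_of_pos (Real.exp_pos _), Real.log_exp, neg_neg,
      ENNReal.ofReal_toReal hx]

/-- Continuity at `⊤` is what makes a product with a divergent sum of logarithms converge to 0. -/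
theorem continuous_expNeg : Continuous expNeg := by
  rw [continuous_iff_continuousAt]
  intro x
  rcases eq_or_ne x ⊤ with rfl | hx
  · rw [ContinuousAt, expNeg_top, tendsto_order]
    refine ⟨fun a ha => Eventually.of_forall fun y => ha.trans_le (expNeg_nonneg y), fun a ha => ?_⟩
    filter_upwards [lt_mem_nhds (ENNReal.ofReal_lt_top (r := -Real.log a))] with y hy
    rcases eq_or_ne y ⊤ with rfl | hy'
    · simpa using ha
    · rw [expNeg, if_neg hy']
      rw [← Real.lt_log_iff_exp_lt ha]
      by_contra! hle
      refine hy.not_ge ?_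
      rw [← ENNReal.ofReal_toReal hy']
      exact ENNReal.ofReal_le_ofReal (by linarith)
  · have h1 : Tendsto (fun y => Real.exp (-y.toReal)) (𝓝 x) (𝓝 (Real.exp (-x.toReal))) :=
      (Real.continuous_exp.tendsto _).comp (ENNReal.tendsto_toReal hx).neg
    rw [ContinuousAt, expNeg, if_neg hx]
    refine h1.congr' ?_
    filter_upwards [isOpen_ne.mem_nhds hx] with y hy
    rw [expNeg, if_neg hy]

/-- A product of numbers in `[0, 1]` in terms of the sum of their logarithms. -/
theorem hasProd_expNeg {ι : Type*} {x : ι → ℝ} (hx : ∀ i, x i ∈ Set.Icc (0 : ℝ) 1) :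
    HasProd x (expNeg (∑' i, negLog (x i))) := by
  have h1 : Tendsto (fun s : Finset ι => expNeg (∑ i ∈ s, negLog (x i))) atTop
      (𝓝 (expNeg (∑' i, negLog (x i)))) :=
    (continuous_expNeg.tendsto _).comp ENNReal.summable.hasSum
  refine h1.congr fun s => ?_
  induction s using Finset.cons_induction with
  | empty => simp
  | cons a s ha ih => rw [Finset.sum_cons, Finset.prod_cons, expNeg_add, ih, expNeg_negLog (hx a)]

/-- The function `t ↦ -log (max (t, ε))` lies below `t ↦ -log t` on `[0, 1]`. -/
theorem ofReal_negLog_max_le (t ε : ℝ) :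
    ENNReal.ofReal (-Real.log (max t ε)) ≤ negLog t := by
  rcases le_or_gt t 0 with ht | ht
  · simp [negLog, ht]
  · rw [negLog_of_pos ht]
    exact ENNReal.ofReal_le_ofReal (neg_le_neg (Real.log_le_log ht (le_max_left _ _)))

/-- For t > 0 the truncation is inactive once 1/(k+1) < t; for t ≤ 0 the values log(k+1) are
unbounded. -/
theorem iSup_ofReal_negLog_max (t : ℝ) :
    ⨆ k : ℕ, ENNReal.ofReal (-Real.log (max t (1 / ((k : ℝ) + 1)))) = negLog t := by
  refine le_antisymm (iSup_le fun k => ofReal_negLog_max_le _ _) ?_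
  have hlim : Tendsto (fun k : ℕ => 1 / ((k : ℝ) + 1)) atTop (𝓝 0) :=
    tendsto_one_div_add_atTop_nhds_zero_nat
  rcases le_or_gt t 0 with ht | ht
  · rw [negLog, if_pos ht, top_le_iff, iSup_eq_top]
    intro b hb
    have h1 : ∀ᶠ k : ℕ in atTop, 1 / ((k : ℝ) + 1) < Real.exp (-b.toReal) :=
      hlim.eventually_lt_const (Real.exp_pos _)
    obtain ⟨k, hk⟩ := h1.exists
    refine ⟨k, ?_⟩
    rw [max_eq_right (ht.trans (by positivity)), ENNReal.lt_ofReal_iff_toReal_lt hb.ne]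
    rw [← Real.log_lt_iff_lt_exp (by positivity)] at hk
    linarith
  · obtain ⟨k, hk⟩ := (hlim.eventually_lt_const ht).exists
    refine le_iSup_of_le k ?_
    rw [max_eq_left hk.le, negLog_of_pos ht]

theorem monotone_ofReal_negLog_max (t : ℝ) :
    Monotone fun k : ℕ => ENNReal.ofReal (-Real.log (max t (1 / ((k : ℝ) + 1)))) := by
  intro k l hkl
  refine ENNReal.ofReal_le_ofReal (neg_le_neg (Real.log_le_log ?_ ?_))
  · exact lt_max_of_lt_right (by positivity)
  · gcongr

variable {K : Type u} [NormedAddCommGroup K] [InnerProductSpace ℂ K] [CompleteSpace K]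

/-- The diagonal entries of a positive operator, in any orthonormal basis, sum up to its trace. -/
theorem IsDensityOperator.tsum_eq_one {D : K →L[ℂ] K} (hD : IsDensityOperator D) {ι : Type*}
    (e : HilbertBasis ι ℂ K) : ∑' i, ENNReal.ofReal (inner ℂ (e i) (D (e i))).re = 1 := by
  rw [← trace_eq_tsum hD.1 e, hD.2]

theorem IsDensityOperator.hasSum_one {D : K →L[ℂ] K} (hD : IsDensityOperator D) {ι : Type*}
    (e : HilbertBasis ι ℂ K) : HasSum (fun i => (inner ℂ (e i) (D (e i))).re) 1 := by
  have h := hD.tsum_eq_one e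
  have h1 := ENNReal.summable_toReal (h.trans_ne ENNReal.one_ne_top)
  have h0 : ∀ i, 0 ≤ (inner ℂ (e i) (D (e i))).re := fun i => hD.1.re_inner_nonneg_right _
  simp only [ENNReal.toReal_ofReal (h0 _)] at h1
  have h3 := h1.hasSum
  rwa [← ENNReal.toReal_ofReal (tsum_nonneg h0), ENNReal.ofReal_tsum_of_nonneg h0 h1, h,
    ENNReal.toReal_one] at h3

theorem IsDensityOperator.eigenvalue_mem_Icc {D : K →L[ℂ] K} (hD : IsDensityOperator D)
    {ι : Type*} (e : HilbertBasis ι ℂ K) {μ : ι → ℝ} (h : ∀ i, D (e i) = (μ i : ℂ) • e i) (i : ι) :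
    μ i ∈ Set.Icc (0 : ℝ) 1 := by
  have h1 : (inner ℂ (e i) (D (e i))).re = μ i := by
    rw [h, inner_smul_right, inner_self_eq_norm_sq_to_K, e.orthonormal.norm_eq_one]
    simp
  rw [← h1]
  exact ⟨hD.1.re_inner_nonneg_right _,
    le_hasSum (hD.hasSum_one e) i fun j _ => hD.1.re_inner_nonneg_right _⟩

/-- `-Tr (D log G) = ∑ⱼ ⟨eⱼ, D eⱼ⟩ (-log μⱼ)` if `G eⱼ = μⱼ eⱼ`. -/
theorem traceMulLog_eq {D G : K →L[ℂ] K} (hD : D.IsPositive) (hG : IsDensityOperator G)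
    {ι : Type*} (e : HilbertBasis ι ℂ K) {μ : ι → ℝ} (h : ∀ i, G (e i) = (μ i : ℂ) • e i) :
    traceMulLog D G
      = -((∑' i, negLog (μ i) * ENNReal.ofReal (inner ℂ (e i) (D (e i))).re : ℝ≥0∞) : EReal) := by
  unfold traceMulLog
  -- The truncated logarithm is continuous because ε > 0, so the functional calculus acts diagonally
  -- on the eigenbasis.
  have h1 : ∀ ε ∈ Set.Ioc (0 : ℝ) 1, expectation D (negLogTrunc G ε)
      = ∑' i, ENNReal.ofReal (-Real.log (max (μ i) ε))
        * ENNReal.ofReal (inner ℂ (e i) (D (e i))).re := by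
    intro ε hε
    refine expectation_eq_tsum e hD (fun i => ?_) fun i => ?_
    · have := Real.log_nonpos (hε.1.le.trans (le_max_right (μ i) ε))
        (max_le (hG.eigenvalue_mem_Icc e h i).2 hε.2)
      linarith
    · refine cfc_apply_of_eigenvector hG.1.isSelfAdjoint ?_ (h i)
      exact (Continuous.log (by fun_prop) fun t => (lt_max_of_lt_right hε.1).ne').neg
  congr 2
  refine le_antisymm (iSup₂_le fun ε hε => ?_) ?_
  · rw [h1 ε hε]
    gcongr
    exact ofReal_negLog_max_le _ _
  -- Monotone convergence: on each finite partial sum the supremum over ε = 1/(k+1) may be taken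
  -- termwise.
  · rw [ENNReal.tsum_eq_iSup_sum]
    refine iSup_le fun s => ?_
    simp only [← iSup_ofReal_negLog_max, ENNReal.iSup_mul]
    rw [ENNReal.finsetSum_iSup_of_monotone]
    · refine iSup_le fun k => ?_
      have hk : 1 / ((k : ℝ) + 1) ∈ Set.Ioc (0 : ℝ) 1 := by
        refine ⟨by positivity, ?_⟩
        rw [div_le_one (by positivity)]
        linarith [k.cast_nonneg (α := ℝ)]
      refine le_iSup₂_of_le (1 / ((k : ℝ) + 1)) hk ?_
      rw [h1 _ hk]
      exact ENNReal.sum_le_tsum s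
    · intro i k l hkl
      exact mul_le_mul_left (monotone_ofReal_negLog_max (μ i) hkl) _

end FermionFock

/-! ## Wedge products of orthonormal vectors and creation operators -/

namespace FermionFock

open Filter Topology

theorem norm_sq_sum_of_orthogonal {E : Type*} [SeminormedAddCommGroup E] [InnerProductSpace ℂ E]
    {κ : Type*} [Fintype κ] {x : κ → E} (hx : ∀ s t, s ≠ t → inner ℂ (x s) (x t) = 0) (c : κ → ℂ) :
    ‖∑ s, c s • x s‖ ^ 2 = ∑ s, ‖c s‖ ^ 2 * ‖x s‖ ^ 2 := by
  classical
  have h1 : inner ℂ (∑ s, c s • x s) (∑ s, c s • x s)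
      = ((∑ s, ‖c s‖ ^ 2 * ‖x s‖ ^ 2 : ℝ) : ℂ) := by
    simp only [sum_inner, inner_sum, inner_smul_left, inner_smul_right]
    push_cast
    refine Finset.sum_congr rfl fun s _ => ?_
    rw [Finset.sum_eq_single s (fun t _ ht => by rw [hx t s ht]; simp) (by simp),
      inner_self_eq_norm_sq_to_K, ← mul_assoc, Complex.mul_conj, Complex.normSq_eq_norm_sq]
    simp
  rw [← inner_self_eq_norm_sq (𝕜 := ℂ), h1]
  rfl

section Alg

variable {H : Type u} [NormedAddCommGroup H] [InnerProductSpace ℂ H] {n : ℕ}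

theorem inner_algWedge_self {v : Fin n → H} (hv : Orthonormal ℂ v) :
    inner ℂ (algWedge v) (algWedge v) = (1 : ℂ) := by
  rw [inner_algWedge, ← Matrix.det_one (n := Fin n)]
  congr 1
  ext i j
  rw [Matrix.of_apply, orthonormal_iff_ite.1 hv, Matrix.one_apply]

theorem norm_algWedge {v : Fin n → H} (hv : Orthonormal ℂ v) : ‖algWedge v‖ = 1 := by
  have h := inner_algWedge_self hv
  have h1 : ‖algWedge v‖ ^ 2 = 1 := by
    rw [← inner_self_eq_norm_sq (𝕜 := ℂ), h]
    rfl
  exact (pow_eq_one_iff_of_nonneg (norm_nonneg _) two_ne_zero).1 h1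

theorem inner_algWedge_eq_zero {v w : Fin n → H} (i : Fin n) (h : ∀ j, inner ℂ (v i) (w j) = 0) :
    inner ℂ (algWedge v) (algWedge w) = 0 := by
  rw [inner_algWedge]
  exact Matrix.det_eq_zero_of_row_eq_zero i h

theorem inner_algWedge_comp_eq_zero {ι : Type*} {e : ι → H} (he : Orthonormal ℂ e)
    {r t : Fin n → ι} {i : Fin n} (h : r i ∉ Set.range t) :
    inner ℂ (algWedge (e ∘ r)) (algWedge (e ∘ t)) = 0 :=
  inner_algWedge_eq_zero i fun j => he.inner_eq_zero fun hij => h ⟨j, hij.symm⟩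

theorem algWedge_eq_zero {v : Fin n → H} {i j : Fin n} (hij : i ≠ j) (h : v i = v j) :
    algWedge v = 0 :=
  AlternatingMap.map_eq_zero_of_eq (exteriorPower.ιMulti ℂ n) v h hij

theorem algWedge_comp_perm (v : Fin n → H) (σ : Equiv.Perm (Fin n)) :
    algWedge (v ∘ σ) = ((Equiv.Perm.sign σ : ℤ) : ℂ) • algWedge v := by
  have h := AlternatingMap.map_perm (exteriorPower.ιMulti ℂ n) v σ
  change exteriorPower.ιMulti ℂ n (v ∘ σ) = _
  rw [h]
  rcases Int.units_eq_one_or (Equiv.Perm.sign σ) with h | h <;> simp [h] <;> rfl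

/-- The wedge product `f ∧ ω`. -/
noncomputable def algCreate (n : ℕ) (f : H) : AlgExterior H n →ₗ[ℂ] AlgExterior H (n + 1) :=
  exteriorPower.alternatingMapLinearEquiv (R := ℂ) (M := H) (N := ⋀[ℂ]^(n + 1) H)
    ((exteriorPower.ιMulti ℂ (n + 1)).curryLeft f)

theorem algCreate_algWedge (f : H) (v : Fin n → H) :
    algCreate n f (algWedge v) = algWedge (Matrix.vecCons f v) :=
  exteriorPower.alternatingMapLinearEquiv_apply_ιMulti (R := ℂ) (M := H)
    (N := ⋀[ℂ]^(n + 1) H) _ _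

theorem algCreate_add (f g : H) : algCreate n (f + g) = algCreate n f + algCreate n g := by
  unfold algCreate
  rw [map_add, map_add]
  rfl

theorem algCreate_smul (c : ℂ) (f : H) : algCreate n (c • f) = c • algCreate n f := by
  unfold algCreate
  rw [map_smul, map_smul]
  rfl

/-- The vectors lie in the span of e, whose exterior power is generated by increasing wedges of e.
This reduces norm estimates to finite orthonormal families. -/
theorem algWedge_mem_span {ι : Type*} [LinearOrder ι] (e : ι → H) {v : Fin n → H}
    (hv : ∀ k, v k ∈ Submodule.span ℂ (Set.range e)) :
    algWedge v ∈ Submodule.span ℂ (Set.range fun s : Set.powersetCard ι n =>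
      algWedge (e ∘ Set.powersetCard.ofFinEmbEquiv.symm s)) := by
  have h := exteriorPower.ιMulti_family_span (n := n) ℂ e
  change algWedge v ∈ Submodule.span ℂ (Set.range (exteriorPower.ιMulti_family ℂ n e))
  rw [← h]
  refine ⟨exteriorPower.ιMulti ℂ n fun k => ⟨v k, hv k⟩, ?_⟩
  rw [exteriorPower.map_apply_ιMulti]
  rfl

theorem inner_algWedge_ofFinEmb {ι : Type*} [LinearOrder ι] {e : ι → H} (he : Orthonormal ℂ e)
    {s t : Set.powersetCard ι n} (hst : s ≠ t) :
    inner ℂ (algWedge (e ∘ Set.powersetCard.ofFinEmbEquiv.symm s))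
      (algWedge (e ∘ Set.powersetCard.ofFinEmbEquiv.symm t)) = 0 := by
  obtain ⟨x, hxt, hxs⟩ := (Set.powersetCard.exists_mem_notMem_iff_ne s t).mp hst
  simp only [← Set.powersetCard.mem_range_ofFinEmbEquiv_symm_iff_mem] at hxs hxt
  obtain ⟨i, rfl⟩ := hxt
  exact inner_algWedge_comp_eq_zero he hxs

/-- A finite family of vectors lies in the span of a finite orthonormal family that contains the
direction of a given vector. -/
theorem exists_orthonormal_span (f : H) (hf : f ≠ 0) (S : Set H) (hS : S.Finite) :
    ∃ (ι : Type u) (_ : Fintype ι) (e : ι → H) (i : ι), Orthonormal ℂ e ∧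
      f = (‖f‖ : ℂ) • e i ∧ S ⊆ Submodule.span ℂ (Set.range e) := by
  classical
  let V : Submodule ℂ H := Submodule.span ℂ (insert f S)
  have hfin : FiniteDimensional ℂ V := FiniteDimensional.span_of_finite ℂ (hS.insert f)
  have hnf : (‖f‖ : ℂ) ≠ 0 := by simpa using hf
  have hfV : ((‖f‖ : ℂ)⁻¹ • f) ∈ V :=
    V.smul_mem _ (Submodule.subset_span (Set.mem_insert _ _))
  let f₀ : V := ⟨(‖f‖ : ℂ)⁻¹ • f, hfV⟩
  have hf₀ : ‖f₀‖ = 1 := by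
    change ‖(‖f‖ : ℂ)⁻¹ • f‖ = 1
    rw [norm_smul]
    simp [hf]
  have horth : Orthonormal ℂ ((↑) : ({f₀} : Set V) → V) := by
    refine ⟨fun i => by rw [i.2, hf₀], fun i j hij => absurd (Subsingleton.elim i j) hij⟩
  obtain ⟨t, b, hsub, hb⟩ := horth.exists_orthonormalBasis_extension
  refine ⟨t, inferInstance, fun i => (b i : H), ⟨f₀, hsub rfl⟩,
    b.orthonormal.comp_linearIsometry V.subtypeₗᵢ, ?_, fun x hx => ?_⟩
  · rw [hb]
    change f = (‖f‖ : ℂ) • ((‖f‖ : ℂ)⁻¹ • f)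
    rw [smul_smul, mul_inv_cancel₀ hnf, one_smul]
  · have hxV : x ∈ V := Submodule.subset_span (Set.mem_insert_of_mem _ hx)
    have h1 : (⟨x, hxV⟩ : V) ∈ Submodule.span ℂ (Set.range b) := by
      rw [← b.coe_toBasis, b.toBasis.span_eq]; trivial
    have h2 := Submodule.mem_map_of_mem (f := V.subtype) h1
    rw [Submodule.map_span, ← Set.range_comp] at h2
    exact h2

/-- Only finitely many vectors occur, so everything can be expanded in a finite orthonormal family
with a member e i₀ in the direction of f. Wedging with e i₀ kills the basis wedges containing i₀ and
maps the others to orthonormal vectors, so it is a contraction; the factor ‖f‖ is what remains. -/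
theorem norm_algCreate_le (f : H) (x : AlgExterior H n) :
    ‖algCreate n f x‖ ≤ ‖f‖ * ‖x‖ := by
  classical
  rcases eq_or_ne f 0 with rfl | hf
  · have h0 : algCreate n (0 : H) = 0 := by
      have := algCreate_smul (n := n) (0 : ℂ) (0 : H)
      simpa using this
    rw [h0]
    simp
  obtain ⟨c, hc⟩ := exists_eq_sum_algWedge x
  let S : Set H := ⋃ v ∈ c.support, Set.range v
  have hSfin : S.Finite := c.support.finite_toSet.biUnion fun v _ => Set.finite_range v
  obtain ⟨ι, hι, e, i₀, he, hfe, hSe⟩ := exists_orthonormal_span f hf S hSfin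
  let _ : LinearOrder ι := linearOrderOfSTO (WellOrderingRel (α := ι))
  have hfinP : Finite (Set.powersetCard ι n) := Subtype.finite
  have hftP : Fintype (Set.powersetCard ι n) := Fintype.ofFinite _
  have hx : x ∈ Submodule.span ℂ (Set.range fun s : Set.powersetCard ι n =>
      algWedge (e ∘ Set.powersetCard.ofFinEmbEquiv.symm s)) := by
    rw [hc]
    refine Submodule.sum_mem _ fun v hv => Submodule.smul_mem _ _ (algWedge_mem_span e fun k => ?_)
    exact hSe (Set.mem_biUnion hv ⟨k, rfl⟩)
  obtain ⟨d, hd⟩ := (Submodule.mem_span_range_iff_exists_fun ℂ).1 hx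
  let y : Set.powersetCard ι n → AlgExterior H (n + 1) := fun s =>
    algWedge (e ∘ Matrix.vecCons i₀ (Set.powersetCard.ofFinEmbEquiv.symm s))
  have hcomp : ∀ s : Set.powersetCard ι n,
      Matrix.vecCons (e i₀) (e ∘ Set.powersetCard.ofFinEmbEquiv.symm s)
      = e ∘ Matrix.vecCons i₀ (Set.powersetCard.ofFinEmbEquiv.symm s) := by
    intro s
    funext k
    refine Fin.cases ?_ (fun k => ?_) k <;> rfl
  have hyd : algCreate n f x = (‖f‖ : ℂ) • ∑ s, d s • y s := by
    conv_lhs => rw [hfe, algCreate_smul, ← hd]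
    simp only [LinearMap.smul_apply, map_sum, map_smul, algCreate_algWedge, hcomp, y,
      Finset.smul_sum, smul_comm (‖f‖ : ℂ)]
  have hmem : ∀ s : Set.powersetCard ι n, i₀ ∈ s → y s = 0 := by
    intro s hs
    rw [← Set.powersetCard.mem_range_ofFinEmbEquiv_symm_iff_mem] at hs
    obtain ⟨k, hk⟩ := hs
    refine algWedge_eq_zero (i := 0) (j := k.succ) (Fin.succ_ne_zero k).symm ?_
    simp [hk]
  have hynorm : ∀ s, ‖y s‖ ≤ 1 := by
    intro s
    by_cases hs : i₀ ∈ s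
    · rw [hmem s hs]
      simp
    · refine (norm_algWedge (he.comp _ ?_)).le
      rw [← Set.powersetCard.mem_range_ofFinEmbEquiv_symm_iff_mem] at hs
      exact Fin.cons_injective_iff.2 ⟨hs, (Set.powersetCard.ofFinEmbEquiv.symm s).injective⟩
  have hyorth : ∀ s t, s ≠ t → inner ℂ (y s) (y t) = 0 := by
    intro s t hst
    by_cases ht : i₀ ∈ t
    · rw [hmem t ht, inner_zero_right]
    by_cases hs : i₀ ∈ s
    · rw [hmem s hs, inner_zero_left]
    obtain ⟨k, hks, hkt⟩ := (Set.powersetCard.exists_mem_notMem_iff_ne s t).mp hst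
    -- The mode k is occupied in the first wedge and absent from the second, also after i₀ is added;
    -- its row in the Gram matrix vanishes.
    have hki : k ≠ i₀ := fun h => hs (h ▸ hks)
    rw [← Set.powersetCard.mem_range_ofFinEmbEquiv_symm_iff_mem] at hks hkt
    obtain ⟨m, rfl⟩ := hks
    refine inner_algWedge_comp_eq_zero he (i := m.succ) ?_
    rw [Matrix.range_cons]
    simp only [Matrix.cons_val_succ]
    rintro (h | h)
    · exact hki h
    · exact hkt h
  have hnx : ‖x‖ ^ 2 = ∑ s, ‖d s‖ ^ 2 := by
    rw [← hd, norm_sq_sum_of_orthogonal fun s t hst => inner_algWedge_ofFinEmb he hst]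
    refine Finset.sum_congr rfl fun s _ => ?_
    rw [norm_algWedge (he.comp _ (Set.powersetCard.ofFinEmbEquiv.symm s).injective)]
    simp
  refine le_of_sq_le_sq ?_ (by positivity)
  rw [hyd, norm_smul, mul_pow, mul_pow, hnx, norm_sq_sum_of_orthogonal hyorth]
  simp only [Complex.norm_real, norm_norm]
  gcongr with s
  refine mul_le_of_le_one_right (sq_nonneg _) ?_
  exact pow_le_one₀ (norm_nonneg _) (hynorm s)

end Alg

end FermionFock

/-! ## Creation operators and the Fock basis -/

namespace FermionFock

open Filter Topology

section Create

variable {H : Type u} [NormedAddCommGroup H] [InnerProductSpace ℂ H]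

theorem inner_wedge {n : ℕ} (v w : Fin n → H) :
    inner ℂ (wedge v) (wedge w) = inner ℂ (algWedge v) (algWedge w) := by
  unfold wedge
  rw [lp.inner_single_left, lp.single_apply_self, UniformSpace.Completion.inner_coe]

theorem inner_wedge_of_ne {n m : ℕ} (h : n ≠ m) (v : Fin n → H) (w : Fin m → H) :
    inner ℂ (wedge v) (wedge w) = 0 := by
  unfold wedge
  rw [lp.inner_single_left, lp.single_apply_ne _ _ _ h, inner_zero_right]

/-- Wedges span the algebraic exterior powers, which are dense in the sectors, and the sectors span
a dense subspace of the direct sum. -/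
theorem fock_ext {E : Type*} [AddCommGroup E] [Module ℂ E] [TopologicalSpace E] [T2Space E]
    {T S : Fock H →L[ℂ] E} (h : ∀ (n : ℕ) (v : Fin n → H), T (wedge v) = S (wedge v)) :
    T = S := by
  refine lp.ext_continuousLinearMap (by simp) fun n => ?_
  ext x
  induction x using UniformSpace.Completion.induction_on with
  | hp => exact isClosed_eq (ContinuousLinearMap.continuous _) (ContinuousLinearMap.continuous _)
  | ih x =>
    obtain ⟨c, rfl⟩ := exists_eq_sum_algWedge x
    have h1 : ∀ v : Fin n → H, ((T.comp (lp.singleContinuousLinearMap ℂ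
          (fun n : ℕ => Sector H n) 2 n)) ((algWedge v : AlgExterior H n) : Sector H n))
        = ((S.comp (lp.singleContinuousLinearMap ℂ
          (fun n : ℕ => Sector H n) 2 n)) ((algWedge v : AlgExterior H n) : Sector H n)) :=
      fun v => h n v
    have h2 : ((∑ v ∈ c.support, c v • algWedge v : AlgExterior H n) : Sector H n)
        = ∑ v ∈ c.support, c v • ((algWedge v : AlgExterior H n) : Sector H n) := by
      change UniformSpace.Completion.toComplL (𝕜 := ℂ) _ = _
      rw [map_sum]
      simp only [map_smul]
      rfl
    rw [h2, map_sum, map_sum]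
    refine Finset.sum_congr rfl fun v _ => ?_
    rw [map_smul, map_smul, h1]

/-- The operator `ω ↦ f ∧ ω` from the `n`-fermion space to the `(n + 1)`-fermion space. -/
noncomputable def sectorCreate (f : H) (n : ℕ) : Sector H n →L[ℂ] Sector H (n + 1) :=
  ((algCreate n f).mkContinuous ‖f‖ (norm_algCreate_le f)).completion

theorem norm_sectorCreate_le (f : H) (n : ℕ) : ‖sectorCreate f n‖ ≤ ‖f‖ := by
  refine ContinuousLinearMap.opNorm_le_bound _ (norm_nonneg _) fun x => ?_
  induction x using UniformSpace.Completion.induction_on with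
  | hp => exact isClosed_le (by fun_prop) (by fun_prop)
  | ih x =>
    rw [sectorCreate, ContinuousLinearMap.completion_apply_coe, UniformSpace.Completion.norm_coe,
      UniformSpace.Completion.norm_coe]
    exact norm_algCreate_le f x

/-- This supplies the isometry that shifts the degree by one in `create`. -/
theorem orthogonalFamily_single_succ :
    OrthogonalFamily ℂ (fun n : ℕ => Sector H (n + 1)) fun n =>
      ({ toLinearMap := (lp.singleContinuousLinearMap ℂ (fun n : ℕ => Sector H n) 2 (n + 1)).toLinearMap
         norm_map' := fun x => lp.norm_single (by simp) (n + 1) x } :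
        Sector H (n + 1) →ₗᵢ[ℂ] Fock H) := by
  intro n m hnm x y
  change inner ℂ (lp.single 2 (n + 1) x : Fock H) (lp.single 2 (m + 1) y) = 0
  rw [lp.inner_single_left, lp.single_apply_ne _ _ _ (by omega), inner_zero_right]

/-- The creation operator `a†(f)`. -/
noncomputable def create (f : H) : Fock H →L[ℂ] Fock H :=
  (orthogonalFamily_single_succ (H := H)).linearIsometry.toContinuousLinearMap.comp
    (lp.mapCLM 2 (sectorCreate f) (norm_nonneg f) (norm_sectorCreate_le f))

theorem norm_create_le (f : H) : ‖create f‖ ≤ ‖f‖ := by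
  refine ContinuousLinearMap.opNorm_le_bound _ (norm_nonneg _) fun x => ?_
  rw [create, ContinuousLinearMap.comp_apply, LinearIsometry.coe_toContinuousLinearMap,
    LinearIsometry.norm_map]
  exact ContinuousLinearMap.le_of_opNorm_le _
    (lp.norm_mapCLM_le 2 (sectorCreate f) (norm_nonneg f) (norm_sectorCreate_le f)) x

theorem create_wedge {n : ℕ} (f : H) (v : Fin n → H) :
    create f (wedge v) = wedge (Matrix.vecCons f v) := by
  have h1 : lp.mapCLM 2 (sectorCreate f) (norm_nonneg f) (norm_sectorCreate_le f) (wedge v)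
      = lp.single 2 n ((algWedge (Matrix.vecCons f v) : AlgExterior H (n + 1)) :
          Sector H (n + 1)) := by
    refine lp.ext (funext fun m => ?_)
    rw [lp.mapCLM_apply_coe]
    rcases eq_or_ne m n with rfl | hm
    · rw [wedge, lp.single_apply_self, lp.single_apply_self, sectorCreate,
        ContinuousLinearMap.completion_apply_coe, LinearMap.mkContinuous_apply,
        algCreate_algWedge]
    · rw [wedge, lp.single_apply_ne _ _ _ hm, lp.single_apply_ne _ _ _ hm, map_zero]
  rw [create, ContinuousLinearMap.comp_apply, h1, LinearIsometry.coe_toContinuousLinearMap,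
    OrthogonalFamily.linearIsometry_apply_single]
  rfl

theorem algWedge_vecCons_add {n : ℕ} (f g : H) (v : Fin n → H) :
    algWedge (Matrix.vecCons (f + g) v)
      = algWedge (Matrix.vecCons f v) + algWedge (Matrix.vecCons g v) := by
  rw [← algCreate_algWedge, algCreate_add, LinearMap.add_apply, algCreate_algWedge,
    algCreate_algWedge]

theorem algWedge_vecCons_smul {n : ℕ} (c : ℂ) (f : H) (v : Fin n → H) :
    algWedge (Matrix.vecCons (c • f) v) = c • algWedge (Matrix.vecCons f v) := by
  rw [← algCreate_algWedge, algCreate_smul, LinearMap.smul_apply, algCreate_algWedge]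

/-- The creation operators, as a bounded linear map. -/
noncomputable def createCLM (H : Type u) [NormedAddCommGroup H] [InnerProductSpace ℂ H] :
    H →L[ℂ] Fock H →L[ℂ] Fock H :=
  LinearMap.mkContinuous
    { toFun := create
      map_add' := fun f g => fock_ext fun n v => by
        rw [add_apply, create_wedge, create_wedge, create_wedge, wedge, wedge, wedge,
          algWedge_vecCons_add, UniformSpace.Completion.coe_add, lp.single_add]
      map_smul' := fun c f => fock_ext fun n v => by
        rw [RingHom.id_apply, smul_apply, create_wedge, create_wedge, wedge, wedge,
          algWedge_vecCons_smul, UniformSpace.Completion.coe_smul, lp.single_smul] }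
    1 fun f => by
      rw [one_mul]
      exact norm_create_le f

@[simp]
theorem createCLM_apply (f : H) : createCLM H f = create f := rfl

variable {ι : Type*} [LinearOrder ι]

theorem fockVector_eq_wedge (f : ι → H) {n : ℕ} {s : Finset ι} (h : s.card = n) :
    fockVector f s = wedge (f ∘ s.orderEmbOfFin h) := by
  subst h
  rfl

/-- Sorting the indices costs the sign of a permutation. Only the modulus of this phase matters for
the occupation probabilities. -/
theorem wedge_comp_injective (f : ι → H) {n : ℕ} {r : Fin n → ι} (hr : Function.Injective r) :
    ∃ c : ℂ, ‖c‖ = 1 ∧ wedge (f ∘ r) = c • fockVector f (Finset.univ.image r) := by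
  have hcard : (Finset.univ.image r).card = n :=
    (Finset.card_image_of_injective Finset.univ hr).trans (Finset.card_fin n)
  let σ : Equiv.Perm (Fin n) := ((Finset.univ.image r).orderIsoOfFin hcard).toEquiv.trans
    ((Equiv.setCongr Fintype.coe_image_univ).trans (Equiv.ofInjective r hr).symm)
  have hσ : r ∘ σ = (Finset.univ.image r).orderEmbOfFin hcard := by
    ext i
    simp [σ, Equiv.apply_ofInjective_symm]
    rfl
  have h1 : fockVector f (Finset.univ.image r)
      = ((Equiv.Perm.sign σ : ℤ) : ℂ) • wedge (f ∘ r) := by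
    rw [fockVector_eq_wedge f hcard, ← hσ, ← Function.comp_assoc, wedge, algWedge_comp_perm,
      UniformSpace.Completion.coe_smul, lp.single_smul]
    rfl
  refine ⟨((Equiv.Perm.sign σ : ℤ) : ℂ), ?_, ?_⟩
  · rcases Int.units_eq_one_or (Equiv.Perm.sign σ) with h | h <;> simp [h]
  · rw [h1, smul_smul]
    rcases Int.units_eq_one_or (Equiv.Perm.sign σ) with h | h <;> simp [h]

theorem create_fockVector_of_mem (f : ι → H) {i : ι} {s : Finset ι} (hi : i ∈ s) :
    create (f i) (fockVector f s) = 0 := by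
  have h : i ∈ Set.range (s.orderEmbOfFin rfl) := by simpa using hi
  obtain ⟨k, hk⟩ := h
  rw [fockVector, create_wedge, wedge, algWedge_eq_zero (i := 0) (j := k.succ)
    (Fin.succ_ne_zero k).symm (by simp [hk]), UniformSpace.Completion.coe_zero, lp.single_zero]

theorem create_fockVector_of_notMem (f : ι → H) {i : ι} {s : Finset ι} (hi : i ∉ s) :
    ∃ c : ℂ, ‖c‖ = 1 ∧ create (f i) (fockVector f s) = c • fockVector f (insert i s) := by
  let r : Fin (s.card + 1) → ι := Matrix.vecCons i (s.orderEmbOfFin rfl)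
  have hr : Function.Injective r :=
    Fin.cons_injective_iff.2 ⟨by simpa using hi, (s.orderEmbOfFin rfl).injective⟩
  obtain ⟨c, hc, h⟩ := wedge_comp_injective f hr
  have himg : Finset.univ.image r = insert i s := by
    rw [← Finset.coe_inj, Finset.coe_image, Finset.coe_univ, Set.image_univ]
    rw [Matrix.range_cons, Finset.range_orderEmbOfFin, Finset.coe_insert, Set.singleton_union]
  refine ⟨c, hc, ?_⟩
  rw [← himg, ← h, fockVector, create_wedge]
  congr 1
  funext k
  refine Fin.cases ?_ (fun k => ?_) k <;> rfl

theorem orthonormal_fockVector {f : ι → H} (hf : Orthonormal ℂ f) :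
    Orthonormal ℂ (fockVector f) := by
  constructor
  · intro s
    have h1 : inner ℂ (fockVector f s) (fockVector f s) = (1 : ℂ) := by
      rw [fockVector, inner_wedge]
      exact inner_algWedge_self (hf.comp _ (s.orderEmbOfFin rfl).injective)
    have h2 : ‖fockVector f s‖ ^ 2 = 1 := by
      rw [← inner_self_eq_norm_sq (𝕜 := ℂ), h1]
      rfl
    exact (pow_eq_one_iff_of_nonneg (norm_nonneg _) two_ne_zero).1 h2
  · intro s t hst
    change inner ℂ (fockVector f s) (fockVector f t) = 0
    rcases eq_or_ne s.card t.card with h | h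
    · obtain ⟨i, his, hit⟩ : ∃ i ∈ s, i ∉ t := by
        by_contra! hsub
        exact hst (Finset.eq_of_subset_of_card_le hsub h.ge)
      have his' : i ∈ Set.range (s.orderEmbOfFin rfl) := by simpa using his
      obtain ⟨k, rfl⟩ := his'
      rw [fockVector, fockVector_eq_wedge f h.symm, inner_wedge]
      refine inner_algWedge_comp_eq_zero hf (i := k) ?_
      simpa using hit
    · exact inner_wedge_of_ne h _ _

/-- The closed span of the Fock vectors is invariant under a†(f_i), hence under every a†(h), by
linearity and continuity in h. Creation operators generate all wedges from the vacuum, which is the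
Fock vector of the empty set. -/
theorem wedge_mem_closure_span_fockVector (f : HilbertBasis ι ℂ H) {n : ℕ} (v : Fin n → H) :
    wedge v ∈ (Submodule.span ℂ (Set.range (fockVector f))).topologicalClosure := by
  set M := (Submodule.span ℂ (Set.range (fockVector f))).topologicalClosure
  have hclosed : IsClosed (M : Set (Fock H)) := Submodule.isClosed_topologicalClosure _
  have hbasis : ∀ s, fockVector f s ∈ M := fun s =>
    Submodule.le_topologicalClosure _ (Submodule.subset_span ⟨s, rfl⟩)
  have h1 : ∀ i, ∀ x ∈ M, create (f i) x ∈ M := by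
    intro i
    have hle : Submodule.span ℂ (Set.range (fockVector f))
        ≤ M.comap (create (f i)).toLinearMap := by
      rw [Submodule.span_le]
      rintro _ ⟨s, rfl⟩
      change create (f i) (fockVector f s) ∈ M
      by_cases hi : i ∈ s
      · rw [create_fockVector_of_mem _ hi]
        exact M.zero_mem
      · obtain ⟨c, -, hc⟩ := create_fockVector_of_notMem f hi
        rw [hc]
        exact M.smul_mem _ (hbasis _)
    exact Submodule.topologicalClosure_minimal _ hle
      (hclosed.preimage (create (f i)).continuous)
  have h2 : ∀ h : H, ∀ x ∈ M, create h x ∈ M := by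
    intro h x hx
    have h3 : HasSum (fun i => createCLM H (f.repr h i • f i) x) (createCLM H h x) :=
      ((f.hasSum_repr h).mapL (createCLM H)).mapL (ContinuousLinearMap.apply ℂ (Fock H) x)
    refine hclosed.mem_of_tendsto h3 (Eventually.of_forall fun s => M.sum_mem fun i _ => ?_)
    rw [map_smul]
    exact M.smul_mem _ (h1 i x hx)
  induction n with
  | zero =>
    have h3 := hbasis ∅
    rw [fockVector_eq_wedge f Finset.card_empty] at h3
    convert h3
  | succ n ih =>
    have h3 := h2 (v 0) _ (ih (Matrix.vecTail v))
    rw [create_wedge] at h3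
    convert h3
    exact (Matrix.cons_head_tail v).symm

/-- The Fock basis of an ordered orthonormal basis of the one-particle space. -/
noncomputable def fockBasis (f : HilbertBasis ι ℂ H) : HilbertBasis (Finset ι) ℂ (Fock H) :=
  HilbertBasis.mkOfOrthogonalEqBot (orthonormal_fockVector f.orthonormal) <| by
    rw [Submodule.eq_bot_iff]
    intro x hx
    have h1 : innerSL ℂ x = 0 := fock_ext fun n v => by
      rw [← Submodule.orthogonal_closure] at hx
      rw [innerSL_apply_apply, ← inner_conj_symm,
        hx _ (wedge_mem_closure_span_fockVector f v)]
      simp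
    have h2 := congrArg (fun T : Fock H →L[ℂ] ℂ => T x) h1
    simpa using h2

@[simp]
theorem fockBasis_apply (f : HilbertBasis ι ℂ H) (s : Finset ι) :
    fockBasis f s = fockVector f s := by
  rw [fockBasis, HilbertBasis.coe_mkOfOrthogonalEqBot]

end Create

end FermionFock

/-! ## The 1-matrix of a density operator -/

namespace FermionFock

open Filter Topology

/-! ### Hilbert–Schmidt norms and moment operators -/

section HilbertSchmidt

variable {K : Type u} [NormedAddCommGroup K] [InnerProductSpace ℂ K] [CompleteSpace K]

/-- The Hilbert-Schmidt norms of an operator and of its adjoint agree, in any bases. -/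
theorem tsum_norm_sq_eq_tsum_norm_sq_adjoint {ι κ : Type*} (b : HilbertBasis ι ℂ K)
    (c : HilbertBasis κ ℂ K) (T : K →L[ℂ] K) :
    ∑' i, ENNReal.ofReal (‖T (b i)‖ ^ 2)
      = ∑' j, ENNReal.ofReal (‖ContinuousLinearMap.adjoint T (c j)‖ ^ 2) := by
  simp only [ofReal_norm_sq_eq_tsum c (T _), ofReal_norm_sq_eq_tsum b (_ : K)]
  rw [ENNReal.tsum_comm]
  refine tsum_congr fun j => tsum_congr fun i => ?_
  rw [ContinuousLinearMap.adjoint_inner_right, norm_inner_symm]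

theorem tsum_norm_sq_eq_tsum_norm_sq {ι κ : Type*} (b : HilbertBasis ι ℂ K)
    (c : HilbertBasis κ ℂ K) (T : K →L[ℂ] K) :
    ∑' i, ENNReal.ofReal (‖T (b i)‖ ^ 2) = ∑' j, ENNReal.ofReal (‖T (c j)‖ ^ 2) :=
  (tsum_norm_sq_eq_tsum_norm_sq_adjoint b c T).trans
    (tsum_norm_sq_eq_tsum_norm_sq_adjoint c c T).symm

/-- The Hilbert–Schmidt norm of √D T is that of its adjoint T†√D, which is at most ‖T‖ times that of
√D, and the latter is 1 because Tr D = 1. -/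
theorem tsum_norm_sq_sqrt_comp_le {D : K →L[ℂ] K} (hD : IsDensityOperator D) {ι : Type*}
    (b : HilbertBasis ι ℂ K) (T : K →L[ℂ] K) :
    ∑' i, ENNReal.ofReal (‖sqrtOp D (T (b i))‖ ^ 2) ≤ ENNReal.ofReal (‖T‖ ^ 2) := by
  have h := tsum_norm_sq_eq_tsum_norm_sq_adjoint b b (sqrtOp D * T)
  have h1 : ∀ x, ContinuousLinearMap.adjoint (sqrtOp D * T) x
      = ContinuousLinearMap.adjoint T (sqrtOp D x) := by
    intro x
    have := (isSelfAdjoint_sqrt D).adjoint_eq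
    rw [show sqrtOp D * T = (sqrtOp D).comp T from rfl, ContinuousLinearMap.adjoint_comp, this]
    rfl
  simp only [h1] at h
  refine h.trans_le ?_
  have h2 := hD.tsum_eq_one b
  simp only [re_inner_apply_self hD.1] at h2
  rw [← mul_one (ENNReal.ofReal (‖T‖ ^ 2)), ← h2, ← ENNReal.tsum_mul_left]
  refine ENNReal.tsum_le_tsum fun i => ?_
  rw [← ENNReal.ofReal_mul (sq_nonneg _), ← mul_pow]
  gcongr
  exact ContinuousLinearMap.le_of_opNorm_le _ (LinearIsometryEquiv.norm_map _ T).le _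

variable {H : Type u} [NormedAddCommGroup H] [InnerProductSpace ℂ H]

/-- The map `h ↦ √D C(h)` with values in the Hilbert-Schmidt operators, which are given by their
values on an orthonormal basis `c`. -/
noncomputable def sqrtComp {D : K →L[ℂ] K} (hD : IsDensityOperator D) (C : H →L[ℂ] K →L[ℂ] K)
    {κ : Type*} (c : HilbertBasis κ ℂ K) : H →L[ℂ] lp (fun _ : κ => K) 2 :=
  have hsum : ∀ (h : H) (s : Finset κ),
      ∑ k ∈ s, ‖sqrtOp D (C h (c k))‖ ^ (2 : ℝ≥0∞).toReal
        ≤ (‖C‖ * ‖h‖) ^ (2 : ℝ≥0∞).toReal := by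
    intro h s
    simp only [ENNReal.toReal_ofNat, Real.rpow_ofNat]
    rw [← ENNReal.ofReal_le_ofReal_iff (sq_nonneg _),
      ENNReal.ofReal_sum_of_nonneg fun _ _ => sq_nonneg _]
    refine (ENNReal.sum_le_tsum s).trans ((tsum_norm_sq_sqrt_comp_le hD c (C h)).trans ?_)
    gcongr
    exact C.le_opNorm h
  LinearMap.mkContinuous
    { toFun := fun h => ⟨fun k => sqrtOp D (C h (c k)), memℓp_gen' (hsum h)⟩
      map_add' := fun f g => lp.ext <| funext fun k => by
        change sqrtOp D (C (f + g) (c k)) = sqrtOp D (C f (c k)) + sqrtOp D (C g (c k))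
        rw [map_add, add_apply, map_add]
      map_smul' := fun a f => lp.ext <| funext fun k => by
        change sqrtOp D (C (a • f) (c k)) = a • sqrtOp D (C f (c k))
        rw [map_smul, smul_apply, map_smul] }
    ‖C‖ fun h => lp.norm_le_of_forall_sum_le (by simp) (by positivity) (hsum h)

variable [CompleteSpace H]

/-- The operator `γ` with `⟪f, γ g⟫ = Tr (D C(g) C(f)†)`. -/
noncomputable def momentOperator {D : K →L[ℂ] K} (hD : IsDensityOperator D)
    (C : H →L[ℂ] K →L[ℂ] K) {κ : Type*} (c : HilbertBasis κ ℂ K) : H →L[ℂ] H :=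
  (ContinuousLinearMap.adjoint (sqrtComp hD C c)).comp (sqrtComp hD C c)

theorem hasSum_inner_momentOperator {D : K →L[ℂ] K} (hD : IsDensityOperator D)
    (C : H →L[ℂ] K →L[ℂ] K) {κ : Type*} (c : HilbertBasis κ ℂ K) (x y : H) :
    HasSum (fun k => inner ℂ (sqrtOp D (C x (c k))) (sqrtOp D (C y (c k))))
      (inner ℂ x (momentOperator hD C c y)) := by
  rw [momentOperator, ContinuousLinearMap.comp_apply, ContinuousLinearMap.adjoint_inner_right]
  exact lp.hasSum_inner _ _

theorem isPositive_momentOperator {D : K →L[ℂ] K} (hD : IsDensityOperator D)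
    (C : H →L[ℂ] K →L[ℂ] K) {κ : Type*} (c : HilbertBasis κ ℂ K) :
    (momentOperator hD C c).IsPositive :=
  ContinuousLinearMap.isPositive_adjoint_comp_self _

/-- Hilbert–Schmidt norms are basis independent, so the basis defining the operator can stay fixed
while the diagonal entries are computed in a Fock basis adapted to x. -/
theorem ofReal_inner_momentOperator {D : K →L[ℂ] K} (hD : IsDensityOperator D)
    (C : H →L[ℂ] K →L[ℂ] K) {ι κ : Type*} (c : HilbertBasis κ ℂ K) (b : HilbertBasis ι ℂ K)
    (x : H) :
    ENNReal.ofReal (inner ℂ x (momentOperator hD C c x)).re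
      = ∑' i, ENNReal.ofReal (‖sqrtOp D (C x (b i))‖ ^ 2) := by
  have h2 := tsum_norm_sq_eq_tsum_norm_sq c b ((sqrtOp D).comp (C x))
  simp only [ContinuousLinearMap.comp_apply] at h2
  rw [← h2]
  have h := (hasSum_inner_momentOperator hD C c x x).mapL Complex.reCLM
  have h1 : ∀ z : K, Complex.reCLM (inner ℂ z z) = ‖z‖ ^ 2 :=
    fun z => inner_self_eq_norm_sq (𝕜 := ℂ) z
  simp only [h1] at h
  rw [← ENNReal.ofReal_tsum_of_nonneg (fun _ => sq_nonneg _) h.summable, h.tsum_eq]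
  rfl

/-- Positivity makes all terms real and nonnegative, and the left side is finite, so an identity in
[0,∞] becomes convergence in ℂ. -/
theorem hasSum_inner_of_tsum_eq {D : K →L[ℂ] K} (hD : D.IsPositive) {T : H →L[ℂ] H}
    (hT : T.IsPositive) {α : Type*} {v : α → K} {x : H}
    (h : ENNReal.ofReal (inner ℂ x (T x)).re = ∑' a, ENNReal.ofReal (inner ℂ (v a) (D (v a))).re) :
    HasSum (fun a => inner ℂ (v a) (D (v a))) (inner ℂ x (T x)) := by
  simp only [inner_apply_self hD, inner_apply_self hT, Complex.ofReal_re] at h ⊢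
  have h2 : Summable fun a => ‖sqrtOp D (v a)‖ ^ 2 := by
    have := ENNReal.summable_toReal (h.symm.trans_ne ENNReal.ofReal_ne_top)
    simpa only [ENNReal.toReal_ofReal (sq_nonneg _)] using this
  rw [← ENNReal.ofReal_tsum_of_nonneg (fun _ => sq_nonneg _) h2,
    ENNReal.ofReal_eq_ofReal_iff (sq_nonneg _) (tsum_nonneg fun _ => sq_nonneg _)] at h
  rw [h]
  exact h2.hasSum.mapL Complex.ofRealCLM

end HilbertSchmidt

/-! ### The 1-matrix as the moment operator of the creation operators -/

variable {H : Type u} [NormedAddCommGroup H] [InnerProductSpace ℂ H]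

section

variable {ι : Type*} [LinearOrder ι]

/-- The sum over the occupation lists in which the mode `i` is empty, in terms of those in which it
is occupied. -/
theorem tsum_create_fockVector {D : Fock H →L[ℂ] Fock H} (hD : D.IsPositive)
    (f : ι → H) (i : ι) :
    ∑' s, ENNReal.ofReal (‖sqrtOp D (create (f i) (fockVector f s))‖ ^ 2)
      = ∑' s : {s : Finset ι // i ∈ s},
        ENNReal.ofReal (inner ℂ (fockVector f s.1) (D (fockVector f s.1))).re := by
  simp only [re_inner_apply_self hD]
  -- Erasing i maps the sets containing i bijectively onto those avoiding it; on the remaining sets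
  -- the term vanishes by the exclusion principle.
  let φ : {s : Finset ι // i ∈ s} → Finset ι := fun s => s.1.erase i
  have hφ : Function.Injective φ := by
    rintro ⟨s, hs⟩ ⟨t, ht⟩ hst
    have hst' : s.erase i = t.erase i := hst
    rw [Subtype.mk.injEq, ← Finset.insert_erase hs, hst', Finset.insert_erase ht]
  rw [← hφ.tsum_eq]
  · refine tsum_congr fun s => ?_
    obtain ⟨c, hc, h⟩ := create_fockVector_of_notMem f (Finset.notMem_erase i s.1)
    rw [h, Finset.insert_erase s.2, map_smul, norm_smul, hc, one_mul]
  · intro s hs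
    by_cases hi : i ∈ s
    · rw [Function.mem_support, create_fockVector_of_mem f hi] at hs
      simp at hs
    · exact ⟨⟨insert i s, Finset.mem_insert_self i s⟩, Finset.erase_insert hi⟩

end

theorem sectorProj_wedge (n : ℕ) {m : ℕ} (v : Fin m → H) :
    sectorProj H n (wedge v) = if m = n then wedge v else 0 := by
  change lp.single 2 n ((wedge v : Fock H) n) = _
  rcases eq_or_ne m n with rfl | h
  · rw [if_pos rfl, wedge, lp.single_apply_self]
  · rw [if_neg h, wedge, lp.single_apply_ne _ _ _ h.symm, lp.single_zero]

variable [CompleteSpace H]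

theorem isOneMatrix_momentOperator {D : Fock H →L[ℂ] Fock H} (hD : IsDensityOperator D) {κ : Type*}
    (c : HilbertBasis κ ℂ (Fock H)) : IsOneMatrix D (momentOperator hD (createCLM H) c) := by
  refine ⟨(isPositive_momentOperator hD _ c).isSelfAdjoint, fun ι _ f i => ?_⟩
  have h1 := ofReal_inner_momentOperator hD (createCLM H) c (fockBasis f) (f i)
  simp only [fockBasis_apply, createCLM_apply] at h1
  rw [tsum_create_fockVector hD.1] at h1
  exact hasSum_inner_of_tsum_eq hD.1 (isPositive_momentOperator hD _ c) h1

theorem exists_hilbertBasis_of_norm_eq_one {x : H} (hx : ‖x‖ = 1) :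
    ∃ (ι : Type u) (f : HilbertBasis ι ℂ H) (i : ι), f i = x := by
  have horth : Orthonormal ℂ ((↑) : ({x} : Set H) → H) := by
    refine ⟨fun i => by rw [i.2, hx], fun i j hij => absurd (Subsingleton.elim i j) hij⟩
  obtain ⟨w, b, hsub, hb⟩ := horth.exists_hilbertBasis_extension
  exact ⟨w, b, ⟨x, hsub rfl⟩, by rw [hb]⟩

/-- Every unit vector belongs to some orthonormal basis, which can be ordered arbitrarily. So the
quadratic forms agree, and polarization finishes. -/
theorem IsOneMatrix.unique {D : Fock H →L[ℂ] Fock H} {γ γ' : H →L[ℂ] H} (h : IsOneMatrix D γ)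
    (h' : IsOneMatrix D γ') : γ = γ' := by
  have h1 : ∀ x : H, ‖x‖ = 1 → inner ℂ x (γ x) = inner ℂ x (γ' x) := by
    intro x hx
    obtain ⟨ι, f, i, rfl⟩ := exists_hilbertBasis_of_norm_eq_one hx
    classical
    let _ : LinearOrder ι := linearOrderOfSTO (WellOrderingRel (α := ι))
    exact (h.2 ι f i).unique (h'.2 ι f i)
  have h2 : ∀ x : H, inner ℂ (γ x) x = inner ℂ (γ' x) x := by
    intro x
    rw [← inner_conj_symm, ← inner_conj_symm (γ' x)]
    congr 1
    rcases eq_or_ne x 0 with rfl | hx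
    · simp
    have hn : (‖x‖ : ℂ) ≠ 0 := by simpa using hx
    have h3 := h1 ((‖x‖ : ℂ)⁻¹ • x) (by rw [norm_smul]; simp [hx])
    simp only [map_smul, inner_smul_left, inner_smul_right] at h3
    rw [Complex.conj_inv, Complex.conj_ofReal] at h3
    exact mul_left_cancel₀ (inv_ne_zero hn) (mul_left_cancel₀ (inv_ne_zero hn) h3)
  exact ContinuousLinearMap.coe_injective ((ext_inner_map _ _).1 h2)

theorem IsOneMatrix.eq_momentOperator {D : Fock H →L[ℂ] Fock H} {γ : H →L[ℂ] H} (h : IsOneMatrix D γ)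
    (hD : IsDensityOperator D) {κ : Type*} (c : HilbertBasis κ ℂ (Fock H)) :
    γ = momentOperator hD (createCLM H) c :=
  h.unique (isOneMatrix_momentOperator hD c)

theorem IsOneMatrix.isPositive {D : Fock H →L[ℂ] Fock H} {γ : H →L[ℂ] H} (h : IsOneMatrix D γ)
    (hD : IsDensityOperator D) : γ.IsPositive := by
  rw [h.eq_momentOperator hD (someBasis (Fock H))]
  exact isPositive_momentOperator hD _ _

section Diagonal

variable {ι : Type u} [LinearOrder ι]

theorem IsOneMatrix.tsum_mem {D : Fock H →L[ℂ] Fock H} {γ : H →L[ℂ] H} (h : IsOneMatrix D γ)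
    (hD : IsDensityOperator D) (f : HilbertBasis ι ℂ H) (i : ι) :
    ∑' s, (if i ∈ s then
        ENNReal.ofReal (inner ℂ (fockVector f s) (D (fockVector f s))).re else 0)
      = ENNReal.ofReal (inner ℂ (f i) (γ (f i))).re := by
  rw [h.eq_momentOperator hD (fockBasis f), 
    ofReal_inner_momentOperator hD _ _ (fockBasis f)]
  simp only [fockBasis_apply, createCLM_apply]
  rw [tsum_create_fockVector hD.1]
  rw [show (∑' s : {s : Finset ι // i ∈ s},
      ENNReal.ofReal (inner ℂ (fockVector f s.1) (D (fockVector f s.1))).re) = _ from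
    tsum_subtype {s : Finset ι | i ∈ s} fun s =>
      ENNReal.ofReal (inner ℂ (fockVector f s) (D (fockVector f s))).re]
  refine tsum_congr fun s => ?_
  by_cases h : i ∈ s <;> simp [h]

/-- The occupation of a mode is a partial sum of the diagonal of D in the Fock basis, whose total is
1. -/
theorem IsOneMatrix.diag_mem_Icc {D : Fock H →L[ℂ] Fock H} {γ : H →L[ℂ] H} (h : IsOneMatrix D γ)
    (hD : IsDensityOperator D) (f : HilbertBasis ι ℂ H) (i : ι) :
    (inner ℂ (f i) (γ (f i))).re ∈ Set.Icc (0 : ℝ) 1 := by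
  refine ⟨(h.isPositive hD).re_inner_nonneg_right _, ?_⟩
  rw [← ENNReal.ofReal_le_one, ← h.tsum_mem hD f i, ← hD.tsum_eq_one (fockBasis f)]
  refine ENNReal.tsum_le_tsum fun s => ?_
  rw [fockBasis_apply]
  split_ifs
  · exact le_rfl
  · exact zero_le

theorem IsOneMatrix.tsum_notMem {D : Fock H →L[ℂ] Fock H} {γ : H →L[ℂ] H} (h : IsOneMatrix D γ)
    (hD : IsDensityOperator D) (f : HilbertBasis ι ℂ H) (i : ι) :
    ∑' s, (if i ∈ s then 0 else
        ENNReal.ofReal (inner ℂ (fockVector f s) (D (fockVector f s))).re)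
      = ENNReal.ofReal (1 - (inner ℂ (f i) (γ (f i))).re) := by
  have h1 := hD.tsum_eq_one (fockBasis f)
  have h2 : ∀ s, ENNReal.ofReal (inner ℂ (fockBasis f s) (D (fockBasis f s))).re
      = (if i ∈ s then ENNReal.ofReal (inner ℂ (fockVector f s) (D (fockVector f s))).re else 0)
      + (if i ∈ s then 0 else
        ENNReal.ofReal (inner ℂ (fockVector f s) (D (fockVector f s))).re) := by
    intro s
    rw [fockBasis_apply]
    split_ifs <;> simp
  simp only [h2] at h1
  rw [ENNReal.tsum_add, h.tsum_mem hD f i] at h1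
  rw [ENNReal.ofReal_sub _ (h.diag_mem_Icc hD f i).1, ENNReal.ofReal_one, ← h1,
    ENNReal.add_sub_cancel_left ENNReal.ofReal_ne_top]

/-- The mean particle number is the trace of the 1-matrix. -/
theorem IsOneMatrix.tsum_eq_meanNumber {D : Fock H →L[ℂ] Fock H} {γ : H →L[ℂ] H}
    (h : IsOneMatrix D γ) (hD : IsDensityOperator D) (f : HilbertBasis ι ℂ H) :
    ∑' i, ENNReal.ofReal (inner ℂ (f i) (γ (f i))).re = meanNumber D := by
  have h1 : ∀ n, expectation D (sectorProj H n) = ∑' s : Finset ι,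
      (if s.card = n then 1 else 0)
        * ENNReal.ofReal (inner ℂ (fockVector f s) (D (fockVector f s))).re := by
    intro n
    rw [expectation_eq_tsum (fockBasis f) hD.1 (a := fun s => if s.card = n then 1 else 0)]
    · refine tsum_congr fun s => ?_
      rw [fockBasis_apply]
      congr 1
      split_ifs <;> simp
    · intro s
      split_ifs <;> norm_num
    · intro s
      rw [fockBasis_apply, fockVector, sectorProj_wedge]
      split_ifs <;> simp
  unfold meanNumber
  simp only [h1, ← ENNReal.tsum_mul_left, ← h.tsum_mem hD f]
  -- After the exchange, both sides count the diagonal entry at s exactly `s.card` times: once per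
  -- occupied mode on the left, through the sector n = `s.card` on the right.
  rw [ENNReal.tsum_comm, ENNReal.tsum_comm (α := ℕ)]
  refine tsum_congr fun s => ?_
  rw [tsum_eq_sum (s := s) (fun i hi => if_neg hi), tsum_eq_single s.card]
  · rw [Finset.sum_congr rfl fun i hi => if_pos hi]
    simp
  · intro n hn
    simp [hn.symm]

/-- If `D` is diagonal in a Fock basis, then its 1-matrix is diagonal in the underlying basis. -/
theorem IsOneMatrix.apply_of_diagonal {D : Fock H →L[ℂ] Fock H} {γ : H →L[ℂ] H}
    (h : IsOneMatrix D γ) (hD : IsDensityOperator D) (f : HilbertBasis ι ℂ H) {w : Finset ι → ℝ}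
    (hw : ∀ s, D (fockVector f s) = (w s : ℂ) • fockVector f s) (i : ι) :
    γ (f i) = ((inner ℂ (f i) (γ (f i))).re : ℂ) • f i := by
  have hw' : ∀ s, D (fockBasis f s) = (w s : ℂ) • fockBasis f s := by simpa using hw
  have hsqrt : ∀ s, sqrtOp D (fockVector f s) = (√(w s) : ℂ) • fockVector f s := fun s =>
    sqrt_apply_of_eigenvector hD.1 (hD.eigenvalue_mem_Icc (fockBasis f) hw' s).1 (hw s)
  have horth := orthonormal_fockVector f.orthonormal
  -- For j ≠ i, adding j and adding i to s give, up to a phase, distinct Fock vectors or zero. √D is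
  -- diagonal on them, so every term vanishes.
  have hoff : ∀ j, j ≠ i → inner ℂ (f j) (γ (f i)) = 0 := by
    intro j hj
    rw [h.eq_momentOperator hD (fockBasis f)]
    refine (hasSum_inner_momentOperator hD (createCLM H) (fockBasis f) (f j) (f i)).unique ?_
    convert hasSum_zero using 1
    ext s
    rw [fockBasis_apply, createCLM_apply, createCLM_apply]
    by_cases his : i ∈ s
    · rw [create_fockVector_of_mem f his]; simp
    by_cases hjs : j ∈ s
    · rw [create_fockVector_of_mem f hjs]; simp
    obtain ⟨c, -, hc⟩ := create_fockVector_of_notMem f his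
    obtain ⟨d, -, hd⟩ := create_fockVector_of_notMem f hjs
    have hne : insert j s ≠ insert i s := fun heq => by
      have : j ∈ insert i s := heq ▸ Finset.mem_insert_self j s
      simp [hj, hjs] at this
    rw [hc, hd, map_smul, map_smul, hsqrt, hsqrt, inner_smul_left, inner_smul_left,
      inner_smul_right, inner_smul_right, horth.inner_eq_zero hne]
    simp
  refine (f.hasSum_repr (γ (f i))).unique ?_
  convert hasSum_single i ?_ using 1
  · rw [f.repr_apply_apply, inner_apply_self (h.isPositive hD), Complex.ofReal_re]
  · intro j hj
    rw [f.repr_apply_apply, hoff j hj, zero_smul]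

end Diagonal

end FermionFock

/-! ## The weights of a free state -/

namespace FermionFock

open Filter Topology

section Weight

/-- The union bound for independent events; it controls the tail of the infinite product. -/
theorem one_sub_sum_le_prod {ι : Type*} {p : ι → ℝ} (hp : ∀ i, p i ∈ Set.Icc (0 : ℝ) 1) (J : Finset ι) :
    1 - ∑ i ∈ J, p i ≤ ∏ i ∈ J, (1 - p i) := by
  induction J using Finset.cons_induction with
  | empty => simp
  | cons a J ha ih =>
    rw [Finset.sum_cons, Finset.prod_cons]
    have h1 : ∏ i ∈ J, (1 - p i) ≤ 1 :=
      Finset.prod_le_one (fun i _ => by linarith [(hp i).2]) fun i _ => by linarith [(hp i).1]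
    nlinarith [(hp a).1, (hp a).2]

variable {ι : Type*} [DecidableEq ι]

/-- The probability `∏ᵢ pᵢ^{𝔫(i)} (1 - pᵢ)^{1 - 𝔫(i)}` of the occupation list `s`. -/
noncomputable def weight (p : ι → ℝ) (s : Finset ι) : ℝ :=
  ∏' i, if i ∈ s then p i else 1 - p i

variable {p : ι → ℝ}

theorem factor_mem_Icc (hp : ∀ i, p i ∈ Set.Icc (0 : ℝ) 1) (s : Finset ι) (i : ι) :
    (if i ∈ s then p i else 1 - p i) ∈ Set.Icc (0 : ℝ) 1 := by
  have h0 := (hp i).1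
  have h1 := (hp i).2
  split_ifs
  · exact hp i
  · exact ⟨by linarith, by linarith⟩

theorem weight_eq_expNeg (hp : ∀ i, p i ∈ Set.Icc (0 : ℝ) 1) (s : Finset ι) :
    weight p s = expNeg (∑' i, negLog (if i ∈ s then p i else 1 - p i)) :=
  (hasProd_expNeg (factor_mem_Icc hp s)).tprod_eq

theorem hasProd_weight (hp : ∀ i, p i ∈ Set.Icc (0 : ℝ) 1) (s : Finset ι) :
    HasProd (fun i => if i ∈ s then p i else 1 - p i) (weight p s) := by
  rw [weight_eq_expNeg hp]
  exact hasProd_expNeg (factor_mem_Icc hp s)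

theorem weight_nonneg (hp : ∀ i, p i ∈ Set.Icc (0 : ℝ) 1) (s : Finset ι) : 0 ≤ weight p s := by
  rw [weight_eq_expNeg hp]
  exact expNeg_nonneg _

/-- Valid also for vanishing weights, where both sides are `⊤`; this is what turns log of a free
state into a sum over modes. -/
theorem negLog_weight (hp : ∀ i, p i ∈ Set.Icc (0 : ℝ) 1) (s : Finset ι) :
    negLog (weight p s) = ∑' i, negLog (if i ∈ s then p i else 1 - p i) := by
  rw [weight_eq_expNeg hp, negLog_expNeg]

/-- Expand ∏ (p_i + (1 - p_i)) = 1. -/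
theorem sum_powerset_prod (p : ι → ℝ) (J : Finset ι) :
    ∑ s ∈ J.powerset, ∏ i ∈ J, (if i ∈ s then p i else 1 - p i) = 1 := by
  have h := Finset.prod_add p (fun i => 1 - p i) J
  simp only [add_sub_cancel, Finset.prod_const_one] at h
  refine Eq.trans ?_ h.symm
  refine Finset.sum_congr rfl fun s hs => ?_
  rw [Finset.mem_powerset] at hs
  rw [← Finset.prod_sdiff hs, mul_comm]
  congr 1
  · exact Finset.prod_congr rfl fun i hi => if_pos hi
  · exact Finset.prod_congr rfl fun i hi => if_neg (Finset.mem_sdiff.1 hi).2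

theorem weight_le_prod (hp : ∀ i, p i ∈ Set.Icc (0 : ℝ) 1) (s J : Finset ι) :
    weight p s ≤ ∏ i ∈ J, (if i ∈ s then p i else 1 - p i) := by
  refine le_of_tendsto (hasProd_weight hp s) ?_
  filter_upwards [eventually_ge_atTop J] with L hL
  exact Finset.prod_le_prod_of_subset_of_le_one hL (fun i _ => (factor_mem_Icc hp s i).1)
    fun i _ _ => (factor_mem_Icc hp s i).2

/-- Outside J all modes are empty, so the remaining factors are 1 - p_i, and the union bound applies
to their product. -/
theorem prod_mul_le_weight (hp : ∀ i, p i ∈ Set.Icc (0 : ℝ) 1) (hs : Summable p)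
    {s J : Finset ι} (hsJ : s ⊆ J) :
    (∏ i ∈ J, if i ∈ s then p i else 1 - p i) * (1 - ∑' i : {i // i ∉ J}, p i) ≤ weight p s := by
  refine ge_of_tendsto (hasProd_weight hp s) ?_
  filter_upwards [eventually_ge_atTop J] with L hL
  rw [← Finset.prod_sdiff hL, mul_comm]
  refine mul_le_mul_of_nonneg_right ?_ (Finset.prod_nonneg fun i _ => (factor_mem_Icc hp s i).1)
  rw [Finset.prod_congr rfl fun i hi =>
    if_neg fun h : i ∈ s => (Finset.mem_sdiff.1 hi).2 (hsJ h)]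
  refine le_trans ?_ (one_sub_sum_le_prod hp _)
  have h1 : ∑ i ∈ L \ J, p i = ∑ i ∈ (L \ J).subtype (· ∉ J), p i := by
    rw [Finset.sum_subtype_of_mem _ fun i hi => (Finset.mem_sdiff.1 hi).2]
  rw [h1]
  have h2 : Summable fun i : {i // i ∉ J} => p i := hs.subtype _
  have h3 := h2.sum_le_tsum ((L \ J).subtype (· ∉ J)) fun i _ => (hp i).1
  exact sub_le_sub_left h3 1

/-- From above, any finite set of lists lies in the power set of some J, where the weights are
dominated by the normalized finite Bernoulli weights. From below, the weights on the power set of J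
lose at most the factor 1 - ∑_{i ∉ J} p_i, which tends to 1 by summability. -/
theorem hasSum_weight (hp : ∀ i, p i ∈ Set.Icc (0 : ℝ) 1) (hs : Summable p) :
    HasSum (weight p) 1 := by
  refine hasSum_of_isLUB_of_nonneg _ (weight_nonneg hp) ⟨?_, ?_⟩
  · rintro _ ⟨S, rfl⟩
    let J := S.biUnion id
    calc ∑ s ∈ S, weight p s ≤ ∑ s ∈ J.powerset, weight p s := by
          refine Finset.sum_le_sum_of_subset_of_nonneg (fun s hs => ?_) fun s _ _ =>
            weight_nonneg hp s
          exact Finset.mem_powerset.2 (Finset.subset_biUnion_of_mem id hs)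
      _ ≤ ∑ s ∈ J.powerset, ∏ i ∈ J, (if i ∈ s then p i else 1 - p i) :=
          Finset.sum_le_sum fun s _ => weight_le_prod hp s J
      _ = 1 := sum_powerset_prod p J
  · intro B hB
    have h1 : ∀ J : Finset ι, 1 - ∑' i : {i // i ∉ J}, p i ≤ B := by
      intro J
      refine le_trans ?_ (hB ⟨J.powerset, rfl⟩)
      calc 1 - ∑' i : {i // i ∉ J}, p i
          = ∑ s ∈ J.powerset, (∏ i ∈ J, (if i ∈ s then p i else 1 - p i))
            * (1 - ∑' i : {i // i ∉ J}, p i) := by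
            rw [← Finset.sum_mul, sum_powerset_prod, one_mul]
        _ ≤ _ := Finset.sum_le_sum fun s hsJ =>
            prod_mul_le_weight hp hs (Finset.mem_powerset.1 hsJ)
    have h2 : Tendsto (fun J : Finset ι => 1 - ∑' i : {i // i ∉ J}, p i) atTop (𝓝 (1 - 0)) :=
      tendsto_const_nhds.sub (tendsto_tsum_compl_atTop_zero p)
    rw [sub_zero] at h2
    exact le_of_tendsto h2 (Eventually.of_forall h1)

/-- The average occupation of the mode `i` is `pᵢ`. -/
theorem hasSum_mem_weight (hp : ∀ i, p i ∈ Set.Icc (0 : ℝ) 1) (hs : Summable p) (i : ι) :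
    HasSum (fun s => if i ∈ s then weight p s else 0) (p i) := by
  -- Condition on mode i being occupied: with p_i replaced by 1, the new weights vanish unless i ∈
  -- s, and p_i times them is the old weight when i ∈ s.
  have hp' : ∀ j, Function.update p i 1 j ∈ Set.Icc (0 : ℝ) 1 := by
    intro j
    rcases eq_or_ne j i with rfl | hj
    · simp
    · simpa [hj] using hp j
  have hs' : Summable (Function.update p i 1) := by
    refine (hs.add (hasSum_ite_eq i (1 - p i)).summable).congr fun j => ?_
    rcases eq_or_ne j i with rfl | hj
    · simp
    · simp [hj]
  have h1 := (hasSum_weight hp' hs').mul_left (p i)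
  rw [mul_one] at h1
  refine h1.congr_fun fun s => ?_
  split_ifs with his
  · refine (hasProd_weight hp s).unique ?_
    convert (hasProd_ite_eq i (p i)).mul (hasProd_weight hp' s) using 1
    ext j
    rcases eq_or_ne j i with rfl | hj
    · simp [his]
    · simp [hj]
  · have h2 : weight (Function.update p i 1) s = 0 :=
      (hasProd_weight hp' s).unique (hasProd_zero_of_exists_eq_zero ⟨i, by simp [his]⟩)
    rw [h2, mul_zero]

theorem sum_add_tsum_ite (h : ι → ℝ≥0∞) (s : Finset ι) :
    ∑ i ∈ s, h i + ∑' i, (if i ∈ s then 0 else h i) = ∑' i, h i := by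
  have h1 : ∀ i, h i = (if i ∈ s then h i else 0) + (if i ∈ s then 0 else h i) := by
    intro i
    split_ifs <;> simp
  rw [tsum_congr h1, ENNReal.tsum_add]
  congr 1
  rw [tsum_eq_sum (s := s) fun i hi => if_neg hi]
  exact Finset.sum_congr rfl fun i hi => (if_pos hi).symm

theorem tsum_negLog_factor (p : ι → ℝ) (s : Finset ι) :
    ∑' i, negLog (if i ∈ s then p i else 1 - p i)
      = ∑ i ∈ s, negLog (p i) + ∑' i, if i ∈ s then 0 else negLog (1 - p i) := by
  rw [← sum_add_tsum_ite _ s]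
  congr 1
  · exact Finset.sum_congr rfl fun i hi => by rw [if_pos hi]
  · refine tsum_congr fun i => ?_
    split_ifs <;> rfl

/-- The finite and the infinite part of a sum of logarithms. -/
theorem tsum_negLog_one_sub (r : ι → ℝ) (v : Finset ι) :
    (∑' i, if i ∈ v then 0 else negLog (1 - r i))
      = (∑' i, if i ∈ v then 0 else if r i < 1 then negLog (1 - r i) else 0)
        + ⊤ * ∑' i, if i ∈ v then 0 else if r i < 1 then 0 else 1 := by
  rw [← ENNReal.tsum_mul_left, ← ENNReal.tsum_add]
  refine tsum_congr fun i => ?_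
  by_cases hi : i ∈ v
  · simp [hi]
  by_cases h : r i < 1
  · simp [hi, h]
  · simp [hi, h, negLog, not_lt.1 h]

/-- The weight of an occupation list is determined by the values of `p` at the occupied modes and
the values of `p` at all modes, both with their multiplicities. -/
theorem weight_eq_weight {κ : Type*} [DecidableEq κ] {q : κ → ℝ}
    (hp : ∀ i, p i ∈ Set.Icc (0 : ℝ) 1) (hq : ∀ j, q j ∈ Set.Icc (0 : ℝ) 1)
    {s : Finset ι} {t : Finset κ}
    (hst : ∀ F : ℝ → ℝ≥0∞, ∑ i ∈ s, F (p i) = ∑ j ∈ t, F (q j))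
    (hall : ∀ F : ℝ → ℝ≥0∞, ∑' i, F (p i) = ∑' j, F (q j)) :
    weight p s = weight q t := by
  -- Cancelling the occupied part requires F to be finite, but -log(1 - x) is infinite at x = 1.
  -- Hence the sum over empty modes is split into a finite-valued function and a count of the modes
  -- with eigenvalue 1.
  have hfin : ∀ F : ℝ → ℝ≥0∞, (∀ x, F x ≠ ⊤) →
      ∑' i, (if i ∈ s then 0 else F (p i)) = ∑' j, (if j ∈ t then 0 else F (q j)) := by
    intro F hF
    have h1 := hall F
    rw [← sum_add_tsum_ite _ s, ← sum_add_tsum_ite _ t, hst F] at h1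
    exact (ENNReal.add_right_inj (ENNReal.sum_ne_top.2 fun j _ => hF _)).1 h1
  rw [weight_eq_expNeg hp, weight_eq_expNeg hq, tsum_negLog_factor, tsum_negLog_factor,
    hst negLog, tsum_negLog_one_sub p s,
    tsum_negLog_one_sub q t,
    hfin (fun x => if x < 1 then negLog (1 - x) else 0),
    hfin (fun x => if x < 1 then 0 else 1)]
  · intro x
    split_ifs <;> simp
  · intro x
    split_ifs with h
    · rw [negLog_of_pos (by linarith)]
      exact ENNReal.ofReal_ne_top
    · simp

end Weight

/-! ### Density operators with prescribed eigenvalues -/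

section Diagonal

variable {K : Type u} [NormedAddCommGroup K] [InnerProductSpace ℂ K] [CompleteSpace K]

/-- The density operator with given eigenvalues along an orthonormal basis. -/
theorem exists_densityOperator {α : Type*} (e : HilbertBasis α ℂ K) {w : α → ℝ}
    (hw : ∀ a, 0 ≤ w a) (hsum : HasSum w 1) :
    ∃ G : K →L[ℂ] K, IsDensityOperator G ∧ (∀ a, G (e a) = (w a : ℂ) • e a) ∧
      ∀ x, HasSum (fun a => ((w a : ℂ) * inner ℂ (e a) x) • e a) (G x) := by
  let T : α → K →L[ℂ] K := fun a => (w a : ℂ) • InnerProductSpace.rankOne ℂ (e a) (e a)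
  -- The rank-one terms have norm w_a, so the series converges absolutely in operator norm.
  have hT : Summable T := by
    refine Summable.of_norm_bounded hsum.summable fun a => ?_
    rw [norm_smul, InnerProductSpace.norm_rankOne, e.orthonormal.norm_eq_one]
    simp [abs_of_nonneg (hw a)]
  have hG : ∀ x, HasSum (fun a => ((w a : ℂ) * inner ℂ (e a) x) • e a) ((∑' a, T a) x) := by
    intro x
    have h := hT.hasSum.mapL (ContinuousLinearMap.apply ℂ K x)
    convert h using 1
    · ext a
      change _ = (w a : ℂ) • (inner ℂ (e a) x • e a)
      rw [smul_smul]
    · rfl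
  have heig : ∀ a, (∑' a, T a) (e a) = (w a : ℂ) • e a := by
    intro a
    refine (hG (e a)).unique ?_
    convert hasSum_single a ?_ using 1
    · rw [inner_self_eq_norm_sq_to_K, e.orthonormal.norm_eq_one]
      simp
    · intro b hb
      rw [e.orthonormal.inner_eq_zero hb]
      simp
  have hpos : (∑' a, T a).IsPositive := by
    constructor
    · intro x y
      change inner ℂ ((∑' a, T a) x) y = inner ℂ x ((∑' a, T a) y)
      rw [← inner_conj_symm, ← e.tsum_inner_mul_inner, ← e.tsum_inner_mul_inner, Complex.conj_tsum]
      refine tsum_congr fun a => ?_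
      rw [inner_apply_of_eigenbasis e heig, inner_apply_of_eigenbasis e heig, map_mul, map_mul,
        inner_conj_symm, inner_conj_symm, Complex.conj_ofReal]
      ring
    · intro x
      have h := hasSum_inner_apply_of_eigenbasis e heig x
      have h1 : 0 ≤ (inner ℂ x ((∑' a, T a) x)).re :=
        h.nonneg fun a => mul_nonneg (hw a) (sq_nonneg _)
      rw [← inner_conj_symm, Complex.conj_re] at h1
      exact h1
  refine ⟨∑' a, T a, ⟨hpos, ?_⟩, heig, hG⟩
  rw [trace_eq_tsum hpos e]
  have h1 : ∀ a, (inner ℂ (e a) ((∑' a, T a) (e a))).re = w a := by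
    intro a
    rw [heig, inner_smul_right, inner_self_eq_norm_sq_to_K, e.orthonormal.norm_eq_one]
    simp
  simp only [h1]
  rw [← ENNReal.ofReal_tsum_of_nonneg hw hsum.summable, hsum.tsum_eq, ENNReal.ofReal_one]

end Diagonal

end FermionFock

/-! ## Free states -/

namespace FermionFock

open Filter Topology

theorem sum_eq_sum_orderEmbOfFin {α M : Type*} [LinearOrder α] [AddCommMonoid M] (v : Finset α)
    {n : ℕ} (h : v.card = n) (r : α → M) : ∑ a ∈ v, r a = ∑ k, r (v.orderEmbOfFin h k) := by
  conv_lhs => rw [← Finset.image_orderEmbOfFin_univ v h]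
  exact Finset.sum_image fun a _ b _ hab => (v.orderEmbOfFin h).injective hab

variable {H : Type u} [NormedAddCommGroup H] [InnerProductSpace ℂ H]

/-- If two Fock basis vectors of eigenbases of the same operator are not orthogonal, then their
occupied modes have the same eigenvalues. -/
theorem sum_eq_sum_of_inner_fockVector_ne_zero {ι κ : Type*} [LinearOrder ι] [LinearOrder κ]
    {γ : H →L[ℂ] H} (hγ : γ.IsSymmetric) {f : ι → H} {g : κ → H} {p : ι → ℝ} {q : κ → ℝ}
    (hf : ∀ i, γ (f i) = (p i : ℂ) • f i) (hg : ∀ j, γ (g j) = (q j : ℂ) • g j)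
    {s : Finset ι} {t : Finset κ} (hst : inner ℂ (fockVector f s) (fockVector g t) ≠ 0)
    {M : Type*} [AddCommMonoid M] (F : ℝ → M) : ∑ i ∈ s, F (p i) = ∑ j ∈ t, F (q j) := by
  have hcard : t.card = s.card := by
    by_contra h
    exact hst (inner_wedge_of_ne (Ne.symm h) _ _)
  rw [fockVector, fockVector_eq_wedge g hcard, inner_wedge, inner_algWedge, Matrix.det_apply] at hst
  -- A nonzero Gram determinant has a nonzero term. Its permutation pairs the modes so that all
  -- overlaps are nonzero, and paired eigenvalues then agree.
  obtain ⟨σ, -, hσ⟩ := Finset.exists_ne_zero_of_sum_ne_zero hst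
  have h1 : ∀ k, p (s.orderEmbOfFin rfl (σ k)) = q (t.orderEmbOfFin hcard k) := by
    intro k
    by_contra hne
    refine hσ ?_
    rw [Finset.prod_eq_zero (Finset.mem_univ k), smul_zero]
    exact inner_eq_zero_of_eigenvalue_ne hγ (hf _) (hg _) hne
  rw [sum_eq_sum_orderEmbOfFin s rfl, sum_eq_sum_orderEmbOfFin t hcard, ← Equiv.sum_comp σ]
  exact Finset.sum_congr rfl fun k _ => by rw [h1]

theorem IsFree.exists_diagonal {G : Fock H →L[ℂ] Fock H} (hG : IsFree G) :
    ∃ (ι : Type u) (_ : LinearOrder ι) (f : HilbertBasis ι ℂ H) (p : ι → ℝ),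
      (∀ i, p i ∈ Set.Icc (0 : ℝ) 1) ∧ Summable p ∧
      ∀ s, G (fockVector f s) = (weight p s : ℂ) • fockVector f s := by
  obtain ⟨-, ι, hι, f, p, hp, hs, h⟩ := hG
  refine ⟨ι, hι, f, p, hp, hs, fun s => (h (fockVector f s)).unique ?_⟩
  have horth := orthonormal_fockVector f.orthonormal
  convert hasSum_single s ?_ using 1
  · rw [inner_self_eq_norm_sq_to_K, horth.norm_eq_one]
    simp [weight]
  · intro t ht
    rw [horth.inner_eq_zero ht]
    simp

section Diagonal

variable {ι : Type u} [LinearOrder ι] (f : HilbertBasis ι ℂ H) {p : ι → ℝ}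
  (hp : ∀ i, p i ∈ Set.Icc (0 : ℝ) 1) (hs : Summable p)

include hp hs

theorem exists_isFree : ∃ G : Fock H →L[ℂ] Fock H, IsFree G ∧
    ∀ s, G (fockVector f s) = (weight p s : ℂ) • fockVector f s := by
  obtain ⟨G, hG, heig, hsum⟩ :=
    exists_densityOperator (fockBasis f) (weight_nonneg hp) (hasSum_weight hp hs)
  simp only [fockBasis_apply] at heig hsum
  exact ⟨G, ⟨hG, ι, inferInstance, f, p, hp, hs, hsum⟩, heig⟩

variable [CompleteSpace H]

/-- The 1-matrix of a free state. -/
theorem IsOneMatrix.apply_of_weight {G : Fock H →L[ℂ] Fock H} {γ : H →L[ℂ] H}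
    (h : IsOneMatrix G γ) (hG : IsDensityOperator G)
    (hw : ∀ s, G (fockVector f s) = (weight p s : ℂ) • fockVector f s) (i : ι) :
    γ (f i) = (p i : ℂ) • f i := by
  have h1 := h.tsum_mem hG f i
  have h2 : ∀ s, (inner ℂ (fockVector f s) (G (fockVector f s))).re = weight p s := by
    intro s
    rw [hw, inner_smul_right, inner_self_eq_norm_sq_to_K,
      (orthonormal_fockVector f.orthonormal).norm_eq_one]
    simp
  simp only [h2] at h1
  have h3 := hasSum_mem_weight hp hs i
  have h4 : ∀ s, (if i ∈ s then ENNReal.ofReal (weight p s) else 0)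
      = ENNReal.ofReal (if i ∈ s then weight p s else 0) := by
    intro s
    split_ifs <;> simp
  simp only [h4] at h1
  rw [← ENNReal.ofReal_tsum_of_nonneg _ h3.summable, h3.tsum_eq,
    ENNReal.ofReal_eq_ofReal_iff (hp i).1 (h.diag_mem_Icc hG f i).1] at h1
  · rw [h.apply_of_diagonal hG f hw, h1]
  · intro s
    split_ifs
    · exact weight_nonneg hp s
    · exact le_rfl

theorem isOneMatrix_of_weight {G : Fock H →L[ℂ] Fock H} {γ : H →L[ℂ] H}
    (hG : IsDensityOperator G)
    (hw : ∀ s, G (fockVector f s) = (weight p s : ℂ) • fockVector f s)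
    (hγ : ∀ i, γ (f i) = (p i : ℂ) • f i) : IsOneMatrix G γ := by
  have h := isOneMatrix_momentOperator hG (fockBasis f)
  rwa [show γ = momentOperator hG (createCLM H) (fockBasis f) from
    ext_of_eigenbasis f fun i => by rw [hγ, h.apply_of_weight f hp hs hG hw]]

end Diagonal

variable [CompleteSpace H]

/-- A free state is determined by its 1-matrix. -/
theorem IsFree.eq_of_isOneMatrix {G G' : Fock H →L[ℂ] Fock H} {γ : H →L[ℂ] H} (hG : IsFree G)
    (hG' : IsFree G') (h : IsOneMatrix G γ) (h' : IsOneMatrix G' γ) : G = G' := by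
  obtain ⟨ι, _, f, p, hp, hps, hf⟩ := hG.exists_diagonal
  obtain ⟨κ, _, g, q, hq, hqs, hg⟩ := hG'.exists_diagonal
  have hγ := (h.isPositive hG.1).isSymmetric
  have hγf := h.apply_of_weight f hp hps hG.1 hf
  have hγg := h'.apply_of_weight g hq hqs hG'.1 hg
  -- Compare matrix elements between the two Fock bases. Both f and g are eigenbases of γ, so a
  -- nonzero overlap forces equal weights.
  refine ext_of_eigenbasis (fockBasis g) fun t => ?_
  refine (fockBasis f).repr.injective (lp.ext (funext fun s => ?_))
  rw [HilbertBasis.repr_apply_apply, HilbertBasis.repr_apply_apply,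
    inner_apply_of_eigenbasis (fockBasis f) (a := fun s => (weight p s : ℂ))
      (by simpa using hf), fockBasis_apply, fockBasis_apply, hg, inner_smul_right]
  by_cases hst : inner ℂ (fockVector f s) (fockVector g t) = 0
  · rw [hst, mul_zero, mul_zero]
  · rw [weight_eq_weight hp hq
      (sum_eq_sum_of_inner_fockVector_ne_zero hγ hγf hγg hst)
      (tsum_eigenvalues_eq hγ f g hγf hγg)]

/-! ### Cross entropies -/

/-- The cross entropy `-x log y - (1 - x) log (1 - y)` of two Bernoulli distributions. -/
noncomputable def crossEntropy (x y : ℝ) : ℝ≥0∞ :=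
  ENNReal.ofReal x * negLog y + ENNReal.ofReal (1 - x) * negLog (1 - y)

theorem crossEntropy_self {x : ℝ} (hx : x ∈ Set.Icc (0 : ℝ) 1) :
    crossEntropy x x = ENNReal.ofReal (-(x * Real.log x))
      + ENNReal.ofReal (-((1 - x) * Real.log (1 - x))) := by
  rw [crossEntropy, ofReal_mul_negLog hx.1, ofReal_mul_negLog (by linarith [hx.2])]

/-- Finiteness excludes exactly the case x > 0, y ≤ 0, where the product is `⊤`. -/
theorem ofReal_mul_negLog_of_ne_top {x y : ℝ} (hx : 0 ≤ x)
    (h : ENNReal.ofReal x * negLog y ≠ ⊤) :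
    (x = 0 ∨ 0 < y) ∧ ENNReal.ofReal x * negLog y = ENNReal.ofReal (-(x * Real.log y)) := by
  rcases hx.eq_or_lt with rfl | hx
  · simp
  rcases le_or_gt y 0 with hy | hy
  · rw [negLog, if_pos hy, ENNReal.mul_top (by simpa using hx)] at h
    exact absurd rfl h
  · exact ⟨Or.inr hy, by rw [negLog_of_pos hy, ← ENNReal.ofReal_mul hx.le, mul_neg]⟩

/-- This is log u ≤ u - 1 at u = y/x, with equality only at u = 1; for x = 0 the logarithmic terms
drop out. -/
theorem mul_log_sub_log_le {x y : ℝ} (hx : 0 ≤ x) (hy : 0 ≤ y) (h : x = 0 ∨ 0 < y) :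
    x * Real.log y - x * Real.log x ≤ y - x ∧
      (x * Real.log y - x * Real.log x = y - x → x = y) := by
  rcases hx.eq_or_lt with rfl | hx
  · simpa using hy
  have hy : 0 < y := h.resolve_left hx.ne'
  have h1 : x * Real.log y - x * Real.log x = x * Real.log (y / x) := by
    rw [Real.log_div hy.ne' hx.ne']
    ring
  have h2 : y - x = x * (y / x - 1) := by
    field_simp
  rw [h1, h2]
  refine ⟨mul_le_mul_of_nonneg_left (Real.log_le_sub_one_of_pos (by positivity)) hx.le,
    fun heq => ?_⟩
  by_contra hne
  have h3 : y / x ≠ 1 := fun h => hne ((div_eq_one_iff_eq hx.ne').1 h).symm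
  have h4 := Real.log_lt_sub_one_of_pos (show 0 < y / x by positivity) h3
  exact h4.ne (mul_left_cancel₀ hx.ne' heq)

/-- Gibbs' inequality for Bernoulli distributions. -/
theorem crossEntropy_self_le {x y : ℝ} (hx : x ∈ Set.Icc (0 : ℝ) 1) (hy : y ∈ Set.Icc (0 : ℝ) 1) :
    crossEntropy x x ≤ crossEntropy x y ∧ (crossEntropy x y = crossEntropy x x → x = y) := by
  have hself := crossEntropy_self hx
  have hfin : crossEntropy x x ≠ ⊤ := by
    rw [hself]
    exact ENNReal.add_ne_top.2 ⟨ENNReal.ofReal_ne_top, ENNReal.ofReal_ne_top⟩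
  rcases eq_or_ne (crossEntropy x y) ⊤ with htop | htop
  · rw [htop]
    exact ⟨le_top, fun h => absurd h.symm hfin⟩
  have hx1 : 0 ≤ 1 - x := by linarith [hx.2]
  have hy1 : 0 ≤ 1 - y := by linarith [hy.2]
  have hlog : ∀ {a b : ℝ}, 0 ≤ a → 0 ≤ b → b ≤ 1 → 0 ≤ -(a * Real.log b) := by
    intro a b ha hb hb1
    have := Real.log_nonpos hb hb1
    nlinarith
  obtain ⟨h1, h2⟩ := ENNReal.add_ne_top.1 htop
  obtain ⟨h1, h1'⟩ := ofReal_mul_negLog_of_ne_top hx.1 h1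
  obtain ⟨h2, h2'⟩ := ofReal_mul_negLog_of_ne_top hx1 h2
  -- The upper bounds y - x and (1 - y) - (1 - x) cancel on adding, which gives the inequality;
  -- equality in the sum forces equality in each part.
  obtain ⟨h3, h3'⟩ := mul_log_sub_log_le hx.1 hy.1 h1
  obtain ⟨h4, h4'⟩ := mul_log_sub_log_le hx1 hy1 h2
  have hxy : crossEntropy x y
      = ENNReal.ofReal (-(x * Real.log y) + -((1 - x) * Real.log (1 - y))) := by
    rw [crossEntropy, h1', h2', ← ENNReal.ofReal_add (hlog hx.1 hy.1 hy.2)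
      (hlog hx1 hy1 (by linarith [hy.1]))]
  have ha := hlog hx.1 hx.1 hx.2
  have hb := hlog hx1 hx1 (by linarith [hx.1])
  have hc := hlog hx.1 hy.1 hy.2
  have hd := hlog hx1 hy1 (by linarith [hy.1])
  rw [← ENNReal.ofReal_add ha hb] at hself
  rw [hself, hxy]
  refine ⟨ENNReal.ofReal_le_ofReal (by linarith), fun h => ?_⟩
  rw [ENNReal.ofReal_eq_ofReal_iff (by linarith) (by linarith)] at h
  exact h3' (by linarith)

/-- Parseval for each g_j in the basis f inserts the weights needed for a termwise comparison with
the modes f. -/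
theorem tsum_crossEntropy_self {ι κ : Type*} (g : HilbertBasis κ ℂ H) (f : HilbertBasis ι ℂ H)
    (n : κ → ℝ) : ∑' j, crossEntropy (n j) (n j)
    = ∑' i, ∑' j, ENNReal.ofReal (‖inner ℂ (g j) (f i)‖ ^ 2) * crossEntropy (n j) (n j) := by
  rw [ENNReal.tsum_comm]
  refine tsum_congr fun j => ?_
  simp only [norm_inner_symm (g j)]
  rw [ENNReal.tsum_mul_right, ← ofReal_norm_sq_eq_tsum, g.orthonormal.norm_eq_one]
  simp

section Compare

variable {κ : Type*} (g : HilbertBasis κ ℂ H) {γ : H →L[ℂ] H} {n : κ → ℝ}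
  (hg : ∀ j, γ (g j) = (n j : ℂ) • g j) (hn : ∀ j, n j ∈ Set.Icc (0 : ℝ) 1)

include hg hn

-- ⟨x, γ x⟩ is the average of the n_j with probabilities |⟨g_j, x⟩|², and the cross entropy is
-- affine in its first argument.
omit [CompleteSpace H] in
theorem crossEntropy_inner {x : H} (hx : ‖x‖ = 1) (y : ℝ) :
    crossEntropy (inner ℂ x (γ x)).re y
      = ∑' j, ENNReal.ofReal (‖inner ℂ (g j) x‖ ^ 2) * crossEntropy (n j) y := by
  have h1 := hasSum_inner_apply_of_eigenbasis g hg x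
  have h2 := (hasSum_norm_inner_sq g x).sub h1
  simp only [hx, one_pow, ← one_sub_mul] at h2
  unfold crossEntropy
  rw [← h2.tsum_eq, ← h1.tsum_eq,
    ENNReal.ofReal_tsum_of_nonneg
      (fun j => mul_nonneg (by linarith [(hn j).2]) (sq_nonneg _)) h2.summable,
    ENNReal.ofReal_tsum_of_nonneg (fun j => mul_nonneg (hn j).1 (sq_nonneg _)) h1.summable,
    ← ENNReal.tsum_mul_right, ← ENNReal.tsum_mul_right, ← ENNReal.tsum_add]
  refine tsum_congr fun j => ?_
  rw [ENNReal.ofReal_mul (hn j).1, ENNReal.ofReal_mul (by linarith [(hn j).2])]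
  ring

variable {ι : Type*} (f : HilbertBasis ι ℂ H) {p : ι → ℝ} (hp : ∀ i, p i ∈ Set.Icc (0 : ℝ) 1)

include hp

/-- Gibbs' inequality is applied to each pair (n_j, p_i), with weight |⟨g_j, f_i⟩|². -/
theorem tsum_crossEntropy_self_le : ∑' j, crossEntropy (n j) (n j)
    ≤ ∑' i, crossEntropy (inner ℂ (f i) (γ (f i))).re (p i) := by
  rw [tsum_crossEntropy_self g f n]
  refine ENNReal.tsum_le_tsum fun i => ?_
  rw [crossEntropy_inner g hg hn (f.orthonormal.norm_eq_one i)]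
  gcongr with j
  exact (crossEntropy_self_le (hn j) (hp i)).1

/-- With finite totals, one strict inequality among the terms would make the sums differ. So n_j =
p_i whenever g_j and f_i overlap, and f_i lies in the eigenspace of p_i. -/
theorem apply_eq_of_tsum_crossEntropy_eq
    (heq : ∑' i, crossEntropy (inner ℂ (f i) (γ (f i))).re (p i) = ∑' j, crossEntropy (n j) (n j))
    (hfin : ∑' j, crossEntropy (n j) (n j) ≠ ⊤) (i : ι) : γ (f i) = (p i : ℂ) • f i := by
  have hle : ∀ i j, ENNReal.ofReal (‖inner ℂ (g j) (f i)‖ ^ 2) * crossEntropy (n j) (n j)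
      ≤ ENNReal.ofReal (‖inner ℂ (g j) (f i)‖ ^ 2) * crossEntropy (n j) (p i) := by
    intro i j
    gcongr
    exact (crossEntropy_self_le (hn j) (hp i)).1
  have h1 : ∀ j, inner ℂ (g j) (f i) ≠ 0 → n j = p i := by
    intro j hj
    by_contra hne
    have hlt : crossEntropy (n j) (n j) < crossEntropy (n j) (p i) :=
      lt_of_le_of_ne (crossEntropy_self_le (hn j) (hp i)).1
        fun h => hne ((crossEntropy_self_le (hn j) (hp i)).2 h.symm)
    have hlt' : ENNReal.ofReal (‖inner ℂ (g j) (f i)‖ ^ 2) * crossEntropy (n j) (n j)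
        < ENNReal.ofReal (‖inner ℂ (g j) (f i)‖ ^ 2) * crossEntropy (n j) (p i) :=
      ENNReal.mul_lt_mul_right (by simpa using hj) ENNReal.ofReal_ne_top hlt
    rw [tsum_crossEntropy_self g f n] at heq hfin
    simp only [crossEntropy_inner g hg hn (f.orthonormal.norm_eq_one _)] at heq
    refine (ENNReal.tsum_lt_tsum (i := i) hfin (fun i => ENNReal.tsum_le_tsum (hle i)) ?_).ne'
      heq
    exact ENNReal.tsum_lt_tsum (i := j) (ENNReal.ne_top_of_tsum_ne_top hfin i) (hle i) hlt'
  refine g.repr.injective (lp.ext (funext fun j => ?_))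
  rw [g.repr_apply_apply, g.repr_apply_apply,
    inner_apply_of_eigenbasis g (a := fun j => (n j : ℂ)) hg, inner_smul_right]
  by_cases hj : inner ℂ (g j) (f i) = 0
  · rw [hj, mul_zero, mul_zero]
  · rw [h1 j hj]

end Compare

/-- `-Tr (D log G)` for a free state `G`. -/
theorem traceMulLog_of_weight {ι : Type u} [LinearOrder ι] (f : HilbertBasis ι ℂ H) {p : ι → ℝ}
    (hp : ∀ i, p i ∈ Set.Icc (0 : ℝ) 1) {D G : Fock H →L[ℂ] Fock H} {γ : H →L[ℂ] H}
    (hD : IsDensityOperator D) (hγ : IsOneMatrix D γ) (hG : IsDensityOperator G)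
    (hw : ∀ s, G (fockVector f s) = (weight p s : ℂ) • fockVector f s) :
    traceMulLog D G
      = -((∑' i, crossEntropy (inner ℂ (f i) (γ (f i))).re (p i) : ℝ≥0∞) : EReal) := by
  rw [traceMulLog_eq hD.1 hG (fockBasis f) (μ := weight p) (by simpa using hw)]
  congr 2
  -- The logarithm of the weight splits over modes. After the exchange, mode i collects the
  -- probabilities of being occupied and of being empty, which are ⟨f_i, γ f_i⟩ and its complement.
  simp only [fockBasis_apply, negLog_weight hp, ← ENNReal.tsum_mul_right]
  rw [ENNReal.tsum_comm]
  refine tsum_congr fun i => ?_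
  rw [crossEntropy, ← hγ.tsum_mem hD f i, ← hγ.tsum_notMem hD f i, ← ENNReal.tsum_mul_right,
    ← ENNReal.tsum_mul_right, ← ENNReal.tsum_add]
  refine tsum_congr fun s => ?_
  split_ifs <;> simp [mul_comm]

theorem IsOneMatrix.eigenvalues {D : Fock H →L[ℂ] Fock H} {γ : H →L[ℂ] H} (hγ : IsOneMatrix D γ)
    (hD : IsDensityOperator D) (hnum : meanNumber D < ⊤) {ι : Type u} (g : HilbertBasis ι ℂ H)
    {n : ι → ℝ} (hg : ∀ i, γ (g i) = (n i : ℂ) • g i) :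
    (∀ i, n i ∈ Set.Icc (0 : ℝ) 1) ∧ Summable n := by
  classical
  let _ : LinearOrder ι := linearOrderOfSTO (WellOrderingRel (α := ι))
  have h1 : ∀ i, (inner ℂ (g i) (γ (g i))).re = n i := by
    intro i
    rw [hg, inner_smul_right, inner_self_eq_norm_sq_to_K, g.orthonormal.norm_eq_one]
    simp
  have h2 : ∀ i, n i ∈ Set.Icc (0 : ℝ) 1 := fun i => h1 i ▸ hγ.diag_mem_Icc hD g i
  have h3 := hγ.tsum_eq_meanNumber hD g
  simp only [h1] at h3
  have h4 := ENNReal.summable_toReal (h3.trans_ne hnum.ne)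
  simp only [ENNReal.toReal_ofReal (h2 _).1] at h4
  exact ⟨h2, h4⟩

end FermionFock

/-! ### The variational principle for free states -/

theorem proposition1 {H : Type u} [NormedAddCommGroup H] [InnerProductSpace ℂ H] [CompleteSpace H]
    (D : Fock H →L[ℂ] Fock H) (hD : IsDensityOperator D) (hcomm : CommutesWithNumber D)
    (hnum : meanNumber D < ⊤) (hent : ⊥ < traceMulLog D D) :
    -- `D` has a unique 1-matrix `γ`
    (∃! γ : H →L[ℂ] H, IsOneMatrix D γ) ∧
    ∀ γ : H →L[ℂ] H, IsOneMatrix D γ →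
      -- there is a unique free state `G` with 1-matrix `γ`
      (∃! G : Fock H →L[ℂ] Fock H, IsFree G ∧ IsOneMatrix G γ) ∧
      -- `γ` has an orthonormal basis of eigenvectors
      (∃ (ι : Type u) (g : HilbertBasis ι ℂ H) (n : ι → ℝ), ∀ i, γ (g i) = (n i : ℂ) • g i) ∧
      ∀ G : Fock H →L[ℂ] Fock H, IsFree G → IsOneMatrix G γ →
        -- the value of `S(D|G)` in terms of the natural occupation numbers
        (∀ (ι : Type u) (g : HilbertBasis ι ℂ H) (n : ι → ℝ),
          (∀ i, γ (g i) = (n i : ℂ) • g i) →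
          (∀ i, n i ∈ Set.Icc (0 : ℝ) 1) ∧
          relEntropy D G =
            ((∑' i, ENNReal.ofReal (-(n i * Real.log (n i))) : ℝ≥0∞) : EReal)
            + ((∑' i, ENNReal.ofReal (-((1 - n i) * Real.log (1 - n i))) : ℝ≥0∞) : EReal)
            + traceMulLog D D) ∧
        -- `G` minimizes the relative entropy over all free states
        IsLeast {S : EReal | ∃ F : Fock H →L[ℂ] Fock H, IsFree F ∧ relEntropy D F = S}
          (relEntropy D G) ∧
        -- and is the only minimizer if `Tr (D log G) > -∞`
        (⊥ < traceMulLog D G →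
          ∀ F : Fock H →L[ℂ] Fock H, IsFree F → relEntropy D F = relEntropy D G → F = G) := by
  classical
  refine ⟨⟨_, isOneMatrix_momentOperator hD (someBasis (Fock H)), fun γ hγ =>
    hγ.eq_momentOperator hD _⟩, fun γ hγ => ?_⟩
  have hpos := hγ.isPositive hD
  obtain ⟨κ, g, n, hg⟩ : ∃ (ι : Type u) (g : HilbertBasis ι ℂ H) (n : ι → ℝ),
      ∀ i, γ (g i) = (n i : ℂ) • g i := by
    obtain ⟨w, b, -⟩ := exists_hilbertBasis ℂ H
    let _ : LinearOrder w := linearOrderOfSTO (WellOrderingRel (α := w))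
    exact exists_eigenbasis b hpos ((hγ.tsum_eq_meanNumber hD b).trans_lt hnum)
  obtain ⟨hn, hns⟩ := hγ.eigenvalues hD hnum g hg
  refine ⟨?_, ⟨κ, g, n, hg⟩, fun G hG hGγ => ?_⟩
  · let _ : LinearOrder κ := linearOrderOfSTO (WellOrderingRel (α := κ))
    obtain ⟨G, hG, hGw⟩ := exists_isFree g hn hns
    have hGγ := isOneMatrix_of_weight g hn hns hG.1 hGw hg
    exact ⟨G, ⟨hG, hGγ⟩, fun F hF => hF.1.eq_of_isOneMatrix hG hF.2 hGγ⟩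
  -- The modes defining G form an eigenbasis of γ with eigenvalues p, so each mode contributes
  -- c(p_i, p_i); this sum is the same for every eigenbasis.
  have hvalue : ∀ {ι : Type u} (g : HilbertBasis ι ℂ H) (n : ι → ℝ),
      (∀ i, γ (g i) = (n i : ℂ) • g i) →
      traceMulLog D G = -((∑' j, crossEntropy (n j) (n j) : ℝ≥0∞) : EReal) := by
    intro ι g n hg
    obtain ⟨α, _, f, p, hp, hps, hf⟩ := hG.exists_diagonal
    have hγf := hGγ.apply_of_weight f hp hps hG.1 hf
    rw [traceMulLog_of_weight f hp hD hγ hG.1 hf,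
      ← tsum_eigenvalues_eq hpos.isSymmetric f g hγf hg (fun x => crossEntropy x x)]
    congr 3
    ext i
    congr 1
    rw [hγf, inner_smul_right, inner_self_eq_norm_sq_to_K, f.orthonormal.norm_eq_one]
    simp
  -- A real value is needed in order to cancel this term in `EReal` when relative entropies are
  -- compared for equality.
  obtain ⟨r, hr⟩ : ∃ r : ℝ, traceMulLog D D = r := by
    refine ⟨(traceMulLog D D).toReal, (EReal.coe_toReal ?_ hent.ne').symm⟩
    intro htop
    rw [traceMulLog, EReal.neg_eq_top_iff] at htop
    exact EReal.coe_ennreal_ne_bot _ htop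
  refine ⟨fun ι g n hg => ?_, ⟨⟨G, hG, rfl⟩, ?_⟩, fun hbot F hF hFG => ?_⟩
  · obtain ⟨hn, -⟩ := hγ.eigenvalues hD hnum g hg
    refine ⟨hn, ?_⟩
    rw [relEntropy, hvalue g n hg, neg_neg, ← EReal.coe_ennreal_add, ← ENNReal.tsum_add]
    simp only [crossEntropy_self (hn _)]
  · rintro _ ⟨F, hF, rfl⟩
    obtain ⟨α, _, f, p, hp, -, hf⟩ := hF.exists_diagonal
    rw [relEntropy, relEntropy, hvalue g n hg, traceMulLog_of_weight f hp hD hγ hF.1 hf, neg_neg,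
      neg_neg]
    gcongr
    exact EReal.coe_ennreal_le_coe_ennreal_iff.2 (tsum_crossEntropy_self_le g hg hn f hp)
  · obtain ⟨α, _, f, p, hp, hps, hf⟩ := hF.exists_diagonal
    have hfin : ∑' j, crossEntropy (n j) (n j) ≠ ⊤ := by
      intro htop
      rw [hvalue g n hg, htop] at hbot
      simp at hbot
    rw [relEntropy, relEntropy, hvalue g n hg, traceMulLog_of_weight f hp hD hγ hF.1 hf, neg_neg,
      neg_neg, hr] at hFG
    have heq : ∑' i, crossEntropy (inner ℂ (f i) (γ (f i))).re (p i)
        = ∑' j, crossEntropy (n j) (n j) := by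
      have h := congrArg (fun x : EReal => x - (r : EReal)) hFG
      simp only [EReal.add_sub_cancel_right] at h
      exact_mod_cast h
    have hγf := apply_eq_of_tsum_crossEntropy_eq g hg hn f hp heq hfin
    exact hF.eq_of_isOneMatrix hG (isOneMatrix_of_weight f hp hps hF.1 hf hγf) hGγ
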